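/- Let $\mathbb K=\mathbb Q(q,t)$. For $N\ge 0$, a \emph{shuffle element} in $N$ variables is a rational function $$R(z_1,\dots,z_N)=\frac{r(z_1,\dots,z_N)}{\prod_{1\le i\ne j\le N}(t z_i-q z_j)}\in\mathbb K(z_1,\dots,z_N),$$ where $r$ is a symmetric Laurent polynomial over $\mathbb K$ satisfying the \emph{wheel conditions}: $r(z_1,\dots,z_N)=0$ whenever $\{z_1/z_2,\,z_2/z_3,\,z_3/z_1\}$ equals $\{q,\tfrac1t,\tfrac tq\}$ or $\{t,\tfrac1q,\tfrac qt\}$. The degree of $R$ in a set of $i$ of its variables is the degree in $\xi$ (degree of numerator minus degree of denominator, $-\infty$ for $R=0$) of the rational function obtained by multiplying these variables by $\xi$. Let $m\in\mathbb Z$ and let $n,k\ge 1$ be integers with $\gcd(m,n)=1$. For $l\ge 0$, let $\mathcal S_{m/n}[l]$ be the $\mathbb K$-vector space of shuffle elements in $ln$ variables, homogeneous of degree $lm$, whose degree in any $i$ of the variables is at most $\frac{mi}n$ for all $0\le i\le ln$; equivalently, all limits $\lim_{\xi\to\infty}\xi^{-mi/n}R(\xi z_1,\dots,\xi z_i,z_{i+1},\dots,z_{ln})$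 exist and are finite. For a rational function $R$ in $N=kn$ variables that is regular at $(1,q,\dots,q^{N-1})$, put, with $M=km$, $$\varphi(R)=R(1,q,\dots,q^{N-1})\cdot q^{-\frac{MN-M+N-k}{2}}\prod_{i=1}^{N}\frac{t-q^i}{1-q^i}.$$ \textbf{Lemma.} For any $c\in\mathbb K$ and any sums of tensors $\sum_a R_{1,l}^{(a)}\otimes R_{2,l}^{(a)}\in\mathcal S_{m/n}[l]\otimes_{\mathbb K}\mathcal S_{m/n}[k-l]$, $0<l<k$, there is at most one rational function $R\in\mathbb K(z_1,\dots,z_{kn})$ such that: \begin{itemize} \item $R$ has $kn$ variables and is homogeneous of degree $km$; \item $R$ is a shuffle element (in particular, it satisfies the wheel conditions); \item for every $0<i<kn$, the degree of $R$ in any $i$ of its variables is at most $\frac{mi}n$, with equality only if $i=ln$ for some $0<l<k$; and for every $0<l<k$, $$\lim_{\xi\to\infty}\frac{R(\xi z_1,\dots,\xi z_{ln},z_{ln+1},\dots,z_{kn})}{\xi^{ml}}=\sum_a R_{1,l}^{(a)}(z_1,\dots,z_{ln})\,R_{2,l}^{(a)}(z_{ln+1},\dots,z_{kn});$$ \item $\varphi(R)=c$.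 \end{itemize} -/

import Mathlib

open scoped TensorProduct

noncomputable section

namespace Shuffle

/-- The ground field `ℚ(q, t)` of rational functions in two parameters. -/
def 𝕂 : Type := FractionRing (MvPolynomial (Fin 2) ℚ)

instance : Field 𝕂 := inferInstanceAs (Field (FractionRing (MvPolynomial (Fin 2) ℚ)))

instance : Algebra (MvPolynomial (Fin 2) ℚ) 𝕂 :=
  inferInstanceAs (Algebra (MvPolynomial (Fin 2) ℚ) (FractionRing (MvPolynomial (Fin 2) ℚ)))

instance : IsFractionRing (MvPolynomial (Fin 2) ℚ) 𝕂 :=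
  inferInstanceAs (IsFractionRing (MvPolynomial (Fin 2) ℚ)
    (FractionRing (MvPolynomial (Fin 2) ℚ)))

/-- The parameter `q`. -/
def q : 𝕂 := algebraMap (MvPolynomial (Fin 2) ℚ) 𝕂 (MvPolynomial.X 0)

/-- The parameter `t`. -/
def t : 𝕂 := algebraMap (MvPolynomial (Fin 2) ℚ) 𝕂 (MvPolynomial.X 1)

/-- Polynomials in `z₁, …, z_N` over `ℚ(q, t)` (variables indexed by `Fin N`). -/
abbrev Poly (N : ℕ) : Type := MvPolynomial (Fin N) 𝕂

/-- The field `𝕂(z₁, …, z_N)`. -/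
abbrev RatFn (N : ℕ) : Type := FractionRing (Poly N)

/-- The variable `z_i` as a rational function. -/
def z {N : ℕ} (i : Fin N) : RatFn N := algebraMap (Poly N) (RatFn N) (MvPolynomial.X i)

/-! ### Substitutions -/

/-- The value of a rational function at a point, computed from its reduced fraction. -/
def evalAt {N : ℕ} (x : Fin N → 𝕂) (R : RatFn N) : 𝕂 :=
  MvPolynomial.eval x (IsFractionRing.num (Poly N) R) /
    MvPolynomial.eval x (IsFractionRing.den (Poly N) R : Poly N)

/-- Any fraction representing `R` whose denominator does not vanish at `x` computes the value. -/
theorem evalAt_eq {N : ℕ} (x : Fin N → 𝕂) (R : RatFn N) (a b : Poly N)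
    (hb : MvPolynomial.eval x b ≠ 0)
    (h : R * algebraMap (Poly N) (RatFn N) b = algebraMap (Poly N) (RatFn N) a) :
    evalAt x R = MvPolynomial.eval x a / MvPolynomial.eval x b := by
  have hd : algebraMap (Poly N) (RatFn N) (IsFractionRing.den (Poly N) R : Poly N) ≠ 0 :=
    IsFractionRing.to_map_ne_zero_of_mem_nonZeroDivisors (IsFractionRing.den (Poly N) R).2
  have hR : R * algebraMap (Poly N) (RatFn N) (IsFractionRing.den (Poly N) R : Poly N)
      = algebraMap (Poly N) (RatFn N) (IsFractionRing.num (Poly N) R) := by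
    have := IsFractionRing.mk'_num_den' (Poly N) R
    rw [div_eq_iff hd] at this
    exact this.symm
  have key : IsFractionRing.num (Poly N) R * b
      = a * (IsFractionRing.den (Poly N) R : Poly N) := by
    apply IsFractionRing.injective (Poly N) (RatFn N)
    rw [map_mul, map_mul, ← hR, ← h]
    ring
  have hdvd : (IsFractionRing.den (Poly N) R : Poly N) ∣ b := by
    refine (IsFractionRing.num_den_reduced (Poly N) R).symm.dvd_of_dvd_mul_left ?_
    exact ⟨a, by rw [key, mul_comm]⟩
  have hd' : MvPolynomial.eval x (IsFractionRing.den (Poly N) R : Poly N) ≠ 0 := by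
    intro h0
    obtain ⟨w, hw⟩ := hdvd
    apply hb
    rw [hw, map_mul, h0, zero_mul]
  have := congrArg (MvPolynomial.eval x) key
  rw [map_mul, map_mul] at this
  rw [evalAt, div_eq_div_iff hd' hb, this]

/-- The polynomial substitution `z_i ↦ z_{e i}`. -/
def renamePoly {a N : ℕ} (e : Fin a ↪ Fin N) : Poly a →ₐ[𝕂] RatFn N :=
  (IsScalarTower.toAlgHom 𝕂 (Poly N) (RatFn N)).comp (MvPolynomial.rename e)

theorem renamePoly_injective {a N : ℕ} (e : Fin a ↪ Fin N) :
    Function.Injective (renamePoly e) :=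
  (IsFractionRing.injective (Poly N) (RatFn N)).comp
    (MvPolynomial.rename_injective e e.injective)

/-- The substitution `z_i ↦ z_{e i}` along an injection of the index sets. -/
def renameRat {a N : ℕ} (e : Fin a ↪ Fin N) : RatFn a →ₐ[𝕂] RatFn N :=
  IsFractionRing.liftAlgHom (renamePoly_injective e)

/-- The polynomial substitution `z_i ↦ ξ z_i` for `i ∈ I`, `z_i ↦ z_i` for `i ∉ I`. -/
def scalePoly {N : ℕ} (I : Finset (Fin N)) : Poly N →ₐ[𝕂] RatFunc (RatFn N) :=
  MvPolynomial.aeval fun i => if i ∈ I then RatFunc.X * RatFunc.C (z i) else RatFunc.C (z i)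

theorem scalePoly_injective {N : ℕ} (I : Finset (Fin N)) :
    Function.Injective (scalePoly I) := by
  let f : Poly N →ₐ[𝕂] Polynomial (RatFn N) := MvPolynomial.aeval fun i =>
    if i ∈ I then Polynomial.X * Polynomial.C (z i) else Polynomial.C (z i)
  have h1 : ∀ p, scalePoly I p = algebraMap (Polynomial (RatFn N)) (RatFunc (RatFn N)) (f p) := by
    intro p
    have : scalePoly I
        = (IsScalarTower.toAlgHom 𝕂 (Polynomial (RatFn N)) (RatFunc (RatFn N))).comp f := by
      apply MvPolynomial.algHom_ext
      intro i
      simp only [scalePoly, f, MvPolynomial.aeval_X, AlgHom.comp_apply,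
        IsScalarTower.coe_toAlgHom']
      split_ifs <;> simp only [map_mul, RatFunc.algebraMap_X, RatFunc.algebraMap_C]
    rw [this]; rfl
  have h2 : ∀ p, Polynomial.eval 1 (f p) = algebraMap (Poly N) (RatFn N) p := by
    intro p
    induction p using MvPolynomial.induction_on with
    | C a =>
      simp only [f, MvPolynomial.aeval_C]
      rw [IsScalarTower.algebraMap_apply 𝕂 (RatFn N) (Polynomial (RatFn N))]
      rw [← MvPolynomial.algebraMap_eq, ← IsScalarTower.algebraMap_apply 𝕂 (Poly N) (RatFn N)]
      simp
    | add a b ha hb => rw [map_add, Polynomial.eval_add, ha, hb, map_add]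
    | mul_X a i ha =>
      rw [map_mul, Polynomial.eval_mul, ha, map_mul]
      congr 1
      simp only [f, MvPolynomial.aeval_X]
      split_ifs <;> simp [z]
  intro a b hab
  rw [h1, h1] at hab
  have := RatFunc.algebraMap_injective (RatFn N) hab
  apply IsFractionRing.injective (Poly N) (RatFn N)
  rw [← h2, ← h2, this]

/-- `R ↦ R(…, ξ z_i, …, z_j, …)`, where exactly the variables `z_i` with `i ∈ I` are multiplied
by a new variable `ξ`; the result is a rational function of `ξ` over `𝕂(z₁, …, z_N)`. -/
def scale {N : ℕ} (I : Finset (Fin N)) : RatFn N →ₐ[𝕂] RatFunc (RatFn N) :=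
  IsFractionRing.liftAlgHom (scalePoly_injective I)

/-- `lim_{ξ → ∞} f(ξ) = a` for a rational function `f` of `ξ`: the difference `f - a` is zero or
has negative degree (degree of the numerator minus degree of the denominator). -/
def HasLimit {F : Type*} [Field F] (f : RatFunc F) (a : F) : Prop :=
  f = RatFunc.C a ∨ (f - RatFunc.C a).intDegree < 0

/-! ### The shuffle algebra -/

/-- `R` is a symmetric rational function. -/
def IsSymm {N : ℕ} (R : RatFn N) : Prop :=
  ∀ σ : Equiv.Perm (Fin N), renameRat σ.toEmbedding R = R

/-- `r` is a Laurent polynomial: a polynomial divided by a monomial. -/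
def IsLaurent {N : ℕ} (r : RatFn N) : Prop :=
  ∃ (p : Poly N) (e : ℕ), r * (∏ i, z i) ^ e = algebraMap (Poly N) (RatFn N) p

/-- The wheel conditions, imposed at all points with nonzero coordinates. -/
def Wheel {N : ℕ} (r : RatFn N) : Prop :=
  ∀ x : Fin N → 𝕂, (∀ i, x i ≠ 0) → ∀ a b c : Fin N,
    (({x a / x b, x b / x c, x c / x a} : Set 𝕂) = {q, 1 / t, t / q} ∨
      ({x a / x b, x b / x c, x c / x a} : Set 𝕂) = {t, 1 / q, q / t}) →
    evalAt x r = 0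

/-- The denominator `∏_{i ≠ j} (t z_i - q z_j)`. -/
def shuffleDen (N : ℕ) : RatFn N :=
  ∏ i : Fin N, ∏ j : Fin N, if i = j then 1 else t • z i - q • z j

/-- The elements of the shuffle algebra with `N` variables. -/
def IsShuffle {N : ℕ} (R : RatFn N) : Prop :=
  ∃ r : RatFn N, IsLaurent r ∧ IsSymm r ∧ Wheel r ∧ R = r / shuffleDen N

/-- `R` is homogeneous of total degree `M`: `R(ξ z₁, …, ξ z_N) = ξ^M R(z₁, …, z_N)`. -/
def IsHomog {N : ℕ} (M : ℤ) (R : RatFn N) : Prop :=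
  scale Finset.univ R = RatFunc.X ^ M * RatFunc.C R

/-- The degree of `R` in the variables `z_i`, `i ∈ I`, is at most `d` (the degree of `0` is
`-∞`). -/
def DegLE {N : ℕ} (I : Finset (Fin N)) (R : RatFn N) (d : ℚ) : Prop :=
  R ≠ 0 → ((scale I R).intDegree : ℚ) ≤ d

/-- The degree of `R` in the variables `z_i`, `i ∈ I`, equals `d`. -/
def DegEQ {N : ℕ} (I : Finset (Fin N)) (R : RatFn N) (d : ℚ) : Prop :=
  R ≠ 0 ∧ ((scale I R).intDegree : ℚ) = d

theorem evalAt_laurent {N : ℕ} {x : Fin N → 𝕂} (hx : ∀ i, x i ≠ 0) {r : RatFn N} {p : Poly N}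
    {e : ℕ} (h : r * (∏ i, z i) ^ e = algebraMap (Poly N) (RatFn N) p) :
    evalAt x r = MvPolynomial.eval x p / (∏ i, x i) ^ e := by
  have := evalAt_eq x r p ((∏ i, MvPolynomial.X i) ^ e) (by
    simp only [map_pow, map_prod, MvPolynomial.eval_X]
    exact pow_ne_zero _ (Finset.prod_ne_zero_iff.2 fun i _ => hx i)) (by
    simpa only [map_pow, map_prod, z] using h)
  simpa only [map_pow, map_prod, MvPolynomial.eval_X] using this

theorem laurent_add {N : ℕ} {r s : RatFn N} {p p' : Poly N} {e e' : ℕ}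
    (h : r * (∏ i, z i) ^ e = algebraMap (Poly N) (RatFn N) p)
    (h' : s * (∏ i, z i) ^ e' = algebraMap (Poly N) (RatFn N) p') :
    (r + s) * (∏ i, z i) ^ (e + e') = algebraMap (Poly N) (RatFn N)
      (p * (∏ i, MvPolynomial.X i) ^ e' + p' * (∏ i, MvPolynomial.X i) ^ e) := by
  simp only [map_add, map_mul, map_pow, map_prod, ← h, ← h']
  simp only [z]
  ring

theorem laurent_smul {N : ℕ} (a : 𝕂) {r : RatFn N} {p : Poly N} {e : ℕ}
    (h : r * (∏ i, z i) ^ e = algebraMap (Poly N) (RatFn N) p) :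
    (a • r) * (∏ i, z i) ^ e = algebraMap (Poly N) (RatFn N) (a • p) := by
  rw [Algebra.smul_mul_assoc, h]
  exact ((IsScalarTower.toAlgHom 𝕂 (Poly N) (RatFn N)).toLinearMap.map_smul a p).symm

theorem IsShuffle.add {N : ℕ} {R S : RatFn N} (hR : IsShuffle R) (hS : IsShuffle S) :
    IsShuffle (R + S) := by
  obtain ⟨r, ⟨p, e, hp⟩, hr, wr, rfl⟩ := hR
  obtain ⟨s, ⟨p', e', hp'⟩, hs, ws, rfl⟩ := hS
  refine ⟨r + s, ⟨_, _, laurent_add hp hp'⟩, fun σ => by rw [map_add, hr, hs], ?_,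
    (add_div _ _ _).symm⟩
  intro x hx a b c habc
  have h0 : (∏ i, x i) ≠ 0 := Finset.prod_ne_zero_iff.2 fun i _ => hx i
  have h1 := wr x hx a b c habc
  have h2 := ws x hx a b c habc
  rw [evalAt_laurent hx hp, div_eq_zero_iff] at h1
  rw [evalAt_laurent hx hp', div_eq_zero_iff] at h2
  rw [evalAt_laurent hx (laurent_add hp hp'), map_add, map_mul, map_mul,
    h1.resolve_right (pow_ne_zero _ h0), h2.resolve_right (pow_ne_zero _ h0)]
  simp

theorem IsShuffle.smul {N : ℕ} (a : 𝕂) {R : RatFn N} (hR : IsShuffle R) :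
    IsShuffle (a • R) := by
  obtain ⟨r, ⟨p, e, hp⟩, hr, wr, rfl⟩ := hR
  refine ⟨a • r, ⟨_, _, laurent_smul a hp⟩, fun σ => by rw [map_smul, hr], ?_,
    (smul_div_assoc _ _ _).symm⟩
  intro x hx i j l h
  have h0 : (∏ i, x i) ≠ 0 := Finset.prod_ne_zero_iff.2 fun i _ => hx i
  have h1 := wr x hx i j l h
  rw [evalAt_laurent hx hp, div_eq_zero_iff] at h1
  rw [evalAt_laurent hx (laurent_smul a hp), MvPolynomial.smul_eval,
    h1.resolve_right (pow_ne_zero _ h0)]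
  simp

theorem IsShuffle.zero {N : ℕ} : IsShuffle (0 : RatFn N) := by
  have h : (0 : RatFn N) * (∏ i, z i) ^ 0 = algebraMap (Poly N) (RatFn N) 0 := by simp
  refine ⟨0, ⟨0, 0, h⟩, fun σ => map_zero _, ?_, (zero_div _).symm⟩
  intro x hx a b c _
  rw [evalAt_laurent hx h]
  simp

theorem DegLE.add {N : ℕ} {I : Finset (Fin N)} {R S : RatFn N} {d : ℚ} (hR : DegLE I R d)
    (hS : DegLE I S d) : DegLE I (R + S) d := by
  intro h
  by_cases h1 : R = 0
  · subst h1; rw [zero_add] at h ⊢; exact hS h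
  by_cases h2 : S = 0
  · subst h2; rw [add_zero] at h ⊢; exact hR h
  have inj : Function.Injective (scale I) := (scale I).toRingHom.injective
  have h3 : scale I S ≠ 0 := by rwa [Ne, map_eq_zero_iff _ inj]
  have h4 : scale I R + scale I S ≠ 0 := by rwa [← map_add, Ne, map_eq_zero_iff _ inj]
  have := RatFunc.intDegree_add_le h3 h4
  rw [map_add]
  calc ((scale I R + scale I S).intDegree : ℚ)
      ≤ ((max (scale I R).intDegree (scale I S).intDegree : ℤ) : ℚ) := by exact_mod_cast this
    _ ≤ d := by rw [Int.cast_max]; exact max_le (hR h1) (hS h2)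

theorem DegLE.smul {N : ℕ} {I : Finset (Fin N)} (a : 𝕂) {R : RatFn N} {d : ℚ}
    (hR : DegLE I R d) : DegLE I (a • R) d := by
  intro h
  have ha : a ≠ 0 := fun h0 => h (by rw [h0, zero_smul])
  have h1 : R ≠ 0 := fun h0 => h (by rw [h0, smul_zero])
  have inj : Function.Injective (scale I) := (scale I).toRingHom.injective
  have h3 : scale I R ≠ 0 := by rwa [Ne, map_eq_zero_iff _ inj]
  have h4 : algebraMap 𝕂 (RatFn N) a ≠ 0 := by
    rwa [Ne, map_eq_zero_iff _ (algebraMap 𝕂 (RatFn N)).injective]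
  have h5 : a • scale I R = RatFunc.C (algebraMap 𝕂 (RatFn N) a) * scale I R := by
    rw [Algebra.smul_def, IsScalarTower.algebraMap_apply 𝕂 (RatFn N) (RatFunc (RatFn N)),
      RatFunc.algebraMap_eq_C]
  rw [map_smul, h5, RatFunc.intDegree_mul (by rwa [Ne, map_eq_zero_iff _ RatFunc.C_injective]) h3,
    RatFunc.intDegree_C, zero_add]
  exact hR h1

/-- The piece with `l n` variables (and degree `l m`) of the slope subalgebra of slope `m / n`:
the shuffle elements `R` for which all limits of `R(ξ z₁, …, ξ z_i, z_{i+1}, …) / ξ^{m i / n}` as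
`ξ → ∞` exist and are finite. -/
def slopePiece (m : ℤ) (n l : ℕ) : Submodule 𝕂 (RatFn (l * n)) where
  carrier := {R | IsShuffle R ∧ IsHomog (l * m) R ∧
    ∀ I : Finset (Fin (l * n)), DegLE I R (m * I.card / n)}
  zero_mem' := ⟨IsShuffle.zero, by simp [IsHomog], fun _ h => absurd rfl h⟩
  add_mem' := by
    rintro R S ⟨h1, h2, h3⟩ ⟨h4, h5, h6⟩
    refine ⟨h1.add h4, ?_, fun I => (h3 I).add (h6 I)⟩
    unfold IsHomog at *
    rw [map_add, h2, h5, map_add, mul_add]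
  smul_mem' := by
    rintro a R ⟨h1, h2, h3⟩
    refine ⟨h1.smul a, ?_, fun I => (h3 I).smul a⟩
    unfold IsHomog at *
    rw [map_smul, h2, Algebra.smul_def, Algebra.smul_def, map_mul,
      IsScalarTower.algebraMap_apply 𝕂 (RatFn (l * n)) (RatFunc (RatFn (l * n))),
      RatFunc.algebraMap_eq_C]
    ring

/-- The inclusion of the first `l n` of `k n` variables. -/
def firstVars {k l : ℕ} (n : ℕ) (h : l ≤ k) : Fin (l * n) ↪ Fin (k * n) :=
  Fin.castLEEmb (Nat.mul_le_mul_right n h)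

/-- The inclusion of the last `(k - l) n` of `k n` variables. -/
def lastVars {k l : ℕ} (n : ℕ) (h : l ≤ k) : Fin ((k - l) * n) ↪ Fin (k * n) where
  toFun j := ⟨l * n + j, by
    have h1 : l * n + (k - l) * n = k * n := by rw [← Nat.add_mul, Nat.add_sub_cancel' h]
    have h2 := j.2
    omega⟩
  inj' i j hij := by
    have := congrArg Fin.val hij
    simp only at this
    exact Fin.ext (by omega)

/-- The rational function
`∑ R₁(z₁, …, z_{ln}) R₂(z_{ln+1}, …, z_{kn})` attached to a sum of tensors `∑ R₁ ⊗ R₂`. -/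
def tensorToRat (m : ℤ) (n : ℕ) {k l : ℕ} (h : l ≤ k) :
    slopePiece m n l ⊗[𝕂] slopePiece m n (k - l) →ₗ[𝕂] RatFn (k * n) :=
  LinearMap.mul' 𝕂 (RatFn (k * n)) ∘ₗ
    TensorProduct.map
      ((renameRat (firstVars n h)).toLinearMap ∘ₗ (slopePiece m n l).subtype)
      ((renameRat (lastVars n h)).toLinearMap ∘ₗ (slopePiece m n (k - l)).subtype)

/-- The norm map, with `N = k n` and `M = k m`:
`φ(R) = R(1, q, …, q^{N-1}) q^{-(MN-M+N-k)/2} ∏_{i=1}^N (t - q^i) / (1 - q^i)`.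
For coprime `m` and `n` the integer `MN-M+N-k` is even, so the division is exact. -/
def phi (m : ℤ) (n k : ℕ) (R : RatFn (k * n)) : 𝕂 :=
  evalAt (fun i => q ^ (i : ℕ)) R *
    q ^ (-(((k * m) * (k * n) - k * m + k * n - k : ℤ) / 2)) *
    ∏ i ∈ Finset.Icc 1 (k * n), (t - q ^ i) / (1 - q ^ i)

/-- The four conditions on a rational function `R` in `k n` variables, for given sums of tensors
`T l` with `0 < l < k` (the values of `T` at other `l` play no role) and a given constant `c`. -/
structure IsSolution (m : ℤ) (n k : ℕ) (c : 𝕂)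
    (T : ∀ l : ℕ, slopePiece m n l ⊗[𝕂] slopePiece m n (k - l)) (R : RatFn (k * n)) : Prop where
  /-- `R` is homogeneous of degree `k m`. -/
  homog : IsHomog (k * m) R
  /-- `R` is a shuffle element; in particular it satisfies the wheel conditions. -/
  shuffle : IsShuffle R
  /-- The degree of `R` in any `i ∈ (0, kn)` of its variables is at most `m i / n`. -/
  deg_le : ∀ I : Finset (Fin (k * n)), 0 < I.card → I.card < k * n → DegLE I R (m * I.card / n)
  /-- Equality is possible only for `i = l n` with `0 < l < k`. -/
  deg_eq : ∀ I : Finset (Fin (k * n)), 0 < I.card → I.card < k * n → DegEQ I R (m * I.card / n) →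
    ∃ l : ℕ, 0 < l ∧ l < k ∧ I.card = l * n
  /-- The limits for `i = l n` are the prescribed ones. -/
  limit : ∀ (l : ℕ) (_ : 0 < l) (hl : l < k),
    HasLimit (scale (Finset.univ.filter fun j : Fin (k * n) => (j : ℕ) < l * n) R /
      RatFunc.X ^ (m * l)) (tensorToRat m n hl.le (T l))
  /-- The normalization. -/
  norm : phi m n k R = c

end Shuffle

end

open scoped TensorProduct

noncomputable section

namespace Shuffle

/-! The difference of two solutions has degree strictly below `mi/n` in its first `i` variables, for
all `0 < i < N = kn`: if `i = ln` the limits cancel, otherwise equality is excluded. It is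
homogeneous and vanishes at `(1, q, …, q^{N-1})`, because `φ` only adds a nonzero factor to the
value there. Clearing denominators gives a symmetric polynomial `p` with the wheel conditions, and
the task is to show `p = 0`.

Specialize the variables of `p` to strings, that is, geometric progressions with ratio `q`: the
string `a` has length `l_a` and a free scale `y_a`. All these specializations vanish, by induction
from long strings down to single vertices, where the specialization is `p` itself. Let `l_a ≥ l_b >
0`. The wheels formed by a vertex of `b` and two neighbours on `a` give `2 (l_a - 1) l_b` linear
factors in `y_a, y_b` (`wheelFactor_dvd`). If a vertex of `b` lands just beyond an end of `a`, it
can be moved to `a`, which cuts `b`; this increases `∑ 3^l` (`exists_merge`), so the value is zero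
by induction, and `2 l_b` further factors appear (`mergeFactor_dvd`). Hence `2 l_a l_b` factors for
each pair divide the specialization; their product has degree `2 l_c (N - l_c)` in `y_c` and total
degree `N² - ∑ l_c²`.

With `μ` the slope `m/n` shifted by the cleared monomial, the strict bounds leave degree less than
`μ l_c + l_c (l_c - 1)` in `y_c` for the cofactor, for each nonempty string. Homogeneity makes its
total degree exactly the sum of these numbers, which is impossible unless the specialization is zero
(`eq_zero_of_spec_eq_mul`). The bounds concern proper subsets of the variables, so one case is left:
a single string of length `N`. By symmetry and homogeneity its value is a multiple of `p(1, q, …,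
q^{N-1}) = 0`. -/

open MvPolynomial

/-! ### Binary linear forms: divisibility, degrees, coprimality. -/

section LinearForms

variable {K ι : Type*} [Field K]

/-- The binary linear form `α y_b - β y_a`. -/
def lin (a b : ι) (α β : K) : MvPolynomial ι K := C α * X b - C β * X a

/-- A polynomial vanishing at all points of the torus on the hyperplane `α y_b = β y_a` is
divisible by the linear form `α y_b - β y_a`. -/
theorem lin_dvd_of_eval_eq_zero [Infinite K] {a b : ι} (hab : a ≠ b) {α β : K} (hα : α ≠ 0)
    (hβ : β ≠ 0) {f : MvPolynomial ι K}
    (h : ∀ y : ι → K, (∀ i, y i ≠ 0) → α * y b = β * y a → eval y f = 0) :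
    lin a b α β ∣ f := by
  classical
  -- Solve the equation for `y_b`. The substituted polynomial vanishes on the whole torus, hence
  -- identically, while modulo the form the substitution is the identity.
  let g : ι → MvPolynomial ι K := Function.update X b (C (α⁻¹ * β) * X a)
  have h0 : aeval g f = 0 := by
    refine funext_set (fun _ => {0}ᶜ) (fun _ => (Set.finite_singleton 0).infinite_compl) ?_
    intro y hy
    have hy' : ∀ i, y i ≠ 0 := fun i => hy i trivial
    have h1 : eval y (aeval g f) = eval (Function.update y b (α⁻¹ * β * y a)) f := by
      have : (aeval y).comp (aeval g) = aeval (Function.update y b (α⁻¹ * β * y a)) := by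
        apply algHom_ext
        intro i
        by_cases hi : i = b
        · subst hi; simp [g]
        · simp [g, hi]
      have := DFunLike.congr_fun this f
      simpa [aeval_eq_eval] using this
    rw [h1, map_zero]
    apply h
    · intro i
      by_cases hi : i = b
      · subst hi; simp [hα, hβ, hy']
      · simp [hi, hy']
    · rw [Function.update_self, Function.update_of_ne hab]
      field_simp
  rw [← Ideal.mem_span_singleton, ← Ideal.Quotient.eq_zero_iff_mem]
  have h2 : (Ideal.Quotient.mkₐ K (Ideal.span {lin a b α β})).comp (aeval g)
      = Ideal.Quotient.mkₐ K (Ideal.span {lin a b α β}) := by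
    apply algHom_ext
    intro i
    by_cases hi : i = b
    · subst hi
      rw [AlgHom.comp_apply, aeval_X]
      simp only [g, Function.update_self, Ideal.Quotient.mkₐ_eq_mk]
      rw [eq_comm, Ideal.Quotient.eq, Ideal.mem_span_singleton]
      refine ⟨C α⁻¹, ?_⟩
      rw [lin, sub_mul, mul_right_comm, ← C_mul, mul_inv_cancel₀ hα, mul_right_comm (C β), ← C_mul,
        mul_comm β]
      simp
    · simp [g, hi]
  have h3 := DFunLike.congr_fun h2 f
  rw [AlgHom.comp_apply, h0, map_zero] at h3
  exact h3.symm

theorem eval_lin (a b : ι) (α β : K) (y : ι → K) :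
    eval y (lin a b α β) = α * y b - β * y a := by
  simp [lin]

theorem support_lin [DecidableEq ι] {a b : ι} (hab : a ≠ b) {α β : K} (hα : α ≠ 0) (hβ : β ≠ 0) :
    (lin a b α β).support = {Finsupp.single a 1, Finsupp.single b 1} := by
  have hne : Finsupp.single a 1 ≠ Finsupp.single b 1 := fun h =>
    hab (Finsupp.single_left_injective one_ne_zero h)
  ext d
  rw [mem_support_iff, lin, coeff_sub, coeff_C_mul, coeff_C_mul, coeff_X, coeff_X]
  simp only [Finset.mem_insert, Finset.mem_singleton]
  by_cases h1 : Finsupp.single a 1 = d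
  · subst h1; simp [hne.symm, hβ]
  · by_cases h2 : Finsupp.single b 1 = d
    · subst h2; simp [hne, hα]
    · simp [h1, h2, Ne.symm h1, Ne.symm h2]

/-- `f` has degree `k` in each of `y_a` and `y_b`, does not involve other variables, and has total
degree `k`. -/
def HasPairDegree [DecidableEq ι] (a b : ι) (k : ℕ) (f : MvPolynomial ι K) : Prop :=
  f ≠ 0 ∧ f.totalDegree = k ∧ ∀ c, degreeOf c f = if c = a ∨ c = b then k else 0

variable [DecidableEq ι]

theorem hasPairDegree_lin {a b : ι} (hab : a ≠ b) {α β : K} (hα : α ≠ 0) (hβ : β ≠ 0) :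
    HasPairDegree a b 1 (lin a b α β) := by
  have hs := support_lin hab hα hβ
  refine ⟨fun h => ?_, ?_, fun c => ?_⟩
  · rw [h] at hs
    have : Finsupp.single a 1 ∈ (0 : MvPolynomial ι K).support := by rw [hs]; simp
    simp at this
  · rw [totalDegree, hs]
    simp
  · rw [degreeOf_eq_sup, hs]
    simp only [Finset.sup_insert, Finset.sup_singleton, Finsupp.single_apply]
    by_cases h1 : a = c <;> by_cases h2 : b = c <;> simp [h1, h2, eq_comm]

theorem HasPairDegree.one (a b : ι) : HasPairDegree a b 0 (1 : MvPolynomial ι K) :=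
  ⟨one_ne_zero, totalDegree_one, fun c => by simp⟩

theorem HasPairDegree.mul {a b : ι} {j k : ℕ} {f g : MvPolynomial ι K}
    (hf : HasPairDegree a b j f) (hg : HasPairDegree a b k g) :
    HasPairDegree a b (j + k) (f * g) := by
  refine ⟨mul_ne_zero hf.1 hg.1, ?_, fun c => ?_⟩
  · rw [totalDegree_mul_of_isDomain hf.1 hg.1, hf.2.1, hg.2.1]
  · rw [degreeOf_mul_eq hf.1 hg.1, hf.2.2, hg.2.2]
    split_ifs <;> rfl

theorem HasPairDegree.prod {a b : ι} {k : ℕ} {σ : Type*} (s : Finset σ) {f : σ → MvPolynomial ι K}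
    (hf : ∀ i ∈ s, HasPairDegree a b k (f i)) :
    HasPairDegree a b (s.card * k) (∏ i ∈ s, f i) := by
  classical
  induction s using Finset.induction_on with
  | empty => simpa using HasPairDegree.one a b
  | insert i s hi ih =>
    rw [Finset.prod_insert hi, Finset.card_insert_of_notMem hi, add_comm, add_mul, one_mul]
    exact (hf i (by simp)).mul (ih fun j hj => hf j (by simp [hj]))

theorem irreducible_lin {a b : ι} (hab : a ≠ b) {α β : K} (hα : α ≠ 0) (hβ : β ≠ 0) :
    Irreducible (lin a b α β) := by
  have hd := hasPairDegree_lin hab hα hβ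
  have hunit : ∀ f : MvPolynomial ι K, f ≠ 0 → f.totalDegree = 0 → IsUnit f := by
    intro f hf h
    rw [totalDegree_eq_zero_iff_eq_C] at h
    rw [h]
    refine IsUnit.map C (isUnit_iff_ne_zero.2 fun h0 => hf ?_)
    rw [h, h0, map_zero]
  refine ⟨fun h => ?_, fun f g hfg => ?_⟩
  · obtain ⟨g, hg⟩ := h.exists_right_inv
    have hg0 : g ≠ 0 := right_ne_zero_of_mul (hg.symm ▸ one_ne_zero)
    have := totalDegree_mul_of_isDomain hd.1 hg0
    rw [hg, totalDegree_one, hd.2.1] at this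
    omega
  · have hf0 : f ≠ 0 := left_ne_zero_of_mul (hfg ▸ hd.1)
    have hg0 : g ≠ 0 := right_ne_zero_of_mul (hfg ▸ hd.1)
    have := totalDegree_mul_of_isDomain hf0 hg0
    rw [← hfg, hd.2.1] at this
    rcases Nat.eq_zero_or_pos f.totalDegree with h | h
    · exact Or.inl (hunit f hf0 h)
    · exact Or.inr (hunit g hg0 (by omega))

/-- The first form is irreducible and vanishes at `y_a = α`, `y_b = β`, where the second one does
not. -/
theorem isRelPrime_lin_of_ne {a b : ι} (hab : a ≠ b) {α β α' β' : K} (hα : α ≠ 0) (hβ : β ≠ 0)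
    (h : α' * β ≠ β' * α) : IsRelPrime (lin a b α β) (lin a b α' β') := by
  rw [(irreducible_lin hab hα hβ).isRelPrime_iff_not_dvd]
  intro hd
  have := map_dvd (eval (Function.update (fun _ => α) b β)) hd
  rw [eval_lin, eval_lin] at this
  simp only [Function.update_self, Function.update_of_ne hab] at this
  rw [mul_comm α β, sub_self, zero_dvd_iff, sub_eq_zero] at this
  exact h this

/-- An irreducible form dividing `f` would give `f` positive degree in both `y_a` and `y_b`. -/
theorem isRelPrime_lin_of_pair {a b a' b' : ι} (hab : a ≠ b) {α β : K} (hα : α ≠ 0)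
    (hβ : β ≠ 0) {k : ℕ} {f : MvPolynomial ι K} (hf : HasPairDegree a' b' k f)
    (h : ¬((a = a' ∨ a = b') ∧ (b = a' ∨ b = b'))) : IsRelPrime (lin a b α β) f := by
  have hl := hasPairDegree_lin hab hα hβ
  rw [(irreducible_lin hab hα hβ).isRelPrime_iff_not_dvd]
  rintro ⟨g, hg⟩
  have hg0 : g ≠ 0 := right_ne_zero_of_mul (hg ▸ hf.1)
  apply h
  have key : ∀ c, (c = a ∨ c = b) → (c = a' ∨ c = b') := by
    intro c hc
    by_contra hc'
    have := hf.2.2 c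
    rw [hg, degreeOf_mul_eq hl.1 hg0, hl.2.2 c, if_pos hc, if_neg hc'] at this
    omega
  exact ⟨key a (Or.inl rfl), key b (Or.inr rfl)⟩

end LinearForms

/-! ### Forms with monomial coefficients in two independent parameters. -/

section Generic

variable {K ι : Type*} [Field K]

/-- `q` and `t` are multiplicatively independent. -/
structure Generic (q t : K) : Prop where
  q_ne_zero : q ≠ 0
  t_ne_zero : t ≠ 0
  eq_of_mul_eq : ∀ i j k l : ℤ, q ^ i * t ^ j = q ^ k * t ^ l → i = k ∧ j = l

variable {q t : K}

theorem Generic.infinite (h : Generic q t) : Infinite K :=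
  Infinite.of_injective (fun i : ℤ => q ^ i * t ^ (0 : ℤ)) fun _ _ hij =>
    (h.eq_of_mul_eq _ _ _ _ hij).1

theorem Generic.zpow_ne (h : Generic q t) (i : ℤ) : q ^ i ≠ 0 := zpow_ne_zero _ h.q_ne_zero

theorem Generic.mul_ne (h : Generic q t) (i j : ℤ) : q ^ i * t ^ j ≠ 0 :=
  mul_ne_zero (zpow_ne_zero _ h.q_ne_zero) (zpow_ne_zero _ h.t_ne_zero)

variable [DecidableEq ι]

/-- The form vanishes where `y_b / y_a = q^(i - e) t^j`; the hypothesis says that the two ratios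
differ. -/
theorem Generic.isRelPrime_lin (h : Generic q t) {a b : ι} (hab : a ≠ b) {e i j e' i' j' : ℤ}
    (hne : e' + i ≠ i' + e ∨ j ≠ j') :
    IsRelPrime (lin a b (q ^ e) (q ^ i * t ^ j)) (lin a b (q ^ e') (q ^ i' * t ^ j')) := by
  refine isRelPrime_lin_of_ne hab (h.zpow_ne _) (h.mul_ne _ _) fun heq => ?_
  have := h.eq_of_mul_eq (e' + i) j (i' + e) j' (by
    rw [zpow_add₀ h.q_ne_zero, zpow_add₀ h.q_ne_zero, mul_assoc, heq]; ring)
  omega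

theorem Generic.prod_lin_dvd (h : Generic q t) {a b : ι} (hab : a ≠ b) {σ : Type*} {s : Finset σ}
    {e i j : σ → ℤ} {f : MvPolynomial ι K}
    (hne : ∀ x ∈ s, ∀ y ∈ s, x ≠ y → e y + i x ≠ i y + e x ∨ j x ≠ j y)
    (hf : ∀ x ∈ s, lin a b (q ^ e x) (q ^ i x * t ^ j x) ∣ f) :
    ∏ x ∈ s, lin a b (q ^ e x) (q ^ i x * t ^ j x) ∣ f :=
  Finset.prod_dvd_of_isRelPrime
    (fun x hx y hy hxy => h.isRelPrime_lin hab (hne x hx y hy hxy)) hf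

end Generic

/-! ### Strings and the specialization of variables to them. -/

/-- A decomposition of the index set `V` into strings labelled by `ι`: the vertex `v` lies at the
position `e v` of the string `s v`, and the positions on the string `a` fill the interval
`[lo a, hi a)`. -/
structure Strings (V ι : Type*) where
  s : V → ι
  e : V → ℤ
  lo : ι → ℤ
  hi : ι → ℤ
  lo_le_hi : ∀ a, lo a ≤ hi a
  lo_le : ∀ v, lo (s v) ≤ e v
  lt_hi : ∀ v, e v < hi (s v)
  surj : ∀ a i, lo a ≤ i → i < hi a → ∃ v, s v = a ∧ e v = i
  inj : ∀ u v, s u = s v → e u = e v → u = v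

namespace Strings

variable {V ι K : Type*} [Field K] (S : Strings V ι)

/-- The length of a string. -/
def len (a : ι) : ℕ := (S.hi a - S.lo a).toNat

theorem len_eq (a : ι) : (S.len a : ℤ) = S.hi a - S.lo a :=
  Int.toNat_of_nonneg (sub_nonneg.2 (S.lo_le_hi a))

/-- The vertices on a string. -/
def fiber [Fintype V] [DecidableEq ι] (a : ι) : Finset V := Finset.univ.filter fun v => S.s v = a

theorem mem_fiber [Fintype V] [DecidableEq ι] {a : ι} {v : V} : v ∈ S.fiber a ↔ S.s v = a := by
  simp [fiber]

theorem card_fiber [Fintype V] [DecidableEq ι] (a : ι) : (S.fiber a).card = S.len a := by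
  have : (S.fiber a).card = (Finset.Ico (S.lo a) (S.hi a)).card := by
    refine Finset.card_bij (fun v _ => S.e v) ?_ ?_ ?_
    · intro v hv
      rw [mem_fiber] at hv
      subst hv
      exact Finset.mem_Ico.2 ⟨S.lo_le v, S.lt_hi v⟩
    · intro u hu v hv h
      rw [mem_fiber] at hu hv
      exact S.inj u v (hu.trans hv.symm) h
    · intro i hi
      rw [Finset.mem_Ico] at hi
      obtain ⟨v, hv, hv'⟩ := S.surj a i hi.1 hi.2
      exact ⟨v, S.mem_fiber.2 hv, hv'⟩
  rw [this, Int.card_Ico, len]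

theorem sum_len [Fintype V] [Fintype ι] [DecidableEq ι] : ∑ a, S.len a = Fintype.card V := by
  simp_rw [← card_fiber]
  exact (Finset.card_eq_sum_card_fiberwise (f := S.s) (t := Finset.univ) (by simp)).symm

theorem len_pos_of_mem {v : V} : 0 < S.len (S.s v) := by
  have := S.lo_le v
  have := S.lt_hi v
  have := S.len_eq (S.s v)
  omega

/-- The point with the vertices of each string in geometric progression with ratio `q`. -/
def point (q : K) (y : ι → K) (v : V) : K := q ^ S.e v * y (S.s v)

/-- The specialization of the variables to strings. -/
def spec (q : K) : MvPolynomial V K →ₐ[K] MvPolynomial ι K :=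
  aeval fun v => C (q ^ S.e v) * X (S.s v)

theorem eval_spec (q : K) (y : ι → K) (p : MvPolynomial V K) :
    eval y (S.spec q p) = eval (S.point q y) p := by
  have : (aeval y).comp (S.spec q) = aeval (S.point q y) := by
    apply algHom_ext
    intro i
    simp [spec, point]
  simpa [aeval_eq_eval] using DFunLike.congr_fun this p

/-- Specialization adds up exponents along each string and may cancel terms but creates no others,
so degree bounds on `p` in subsets of variables pass to its specializations. -/
theorem exists_of_mem_support_spec [Fintype V] [DecidableEq ι] {q : K} {p : MvPolynomial V K}
    {d : ι →₀ ℕ}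
    (hd : d ∈ (S.spec q p).support) :
    ∃ m ∈ p.support, ∀ a, d a = ∑ v ∈ S.fiber a, m v := by
  have h1 : S.spec q p = ∑ m ∈ p.support,
      monomial (∑ v, Finsupp.single (S.s v) (m v)) (coeff m p * ∏ v, (q ^ S.e v) ^ m v) := by
    conv_lhs => rw [spec, aeval_def, eval₂_eq']
    refine Finset.sum_congr rfl fun m _ => ?_
    rw [← C_mul_monomial, monomial_sum_prod, algebraMap_eq]
    simp only [mul_pow, ← map_pow, X_pow_eq_monomial, C_mul_monomial, mul_one]
  rw [h1] at hd
  obtain ⟨m, hm, hd⟩ := Finset.mem_biUnion.1 (support_sum hd)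
  refine ⟨m, hm, fun a => ?_⟩
  rw [Finset.mem_singleton.1 (support_monomial_subset hd), Finsupp.finsetSum_apply, fiber,
    Finset.sum_filter]
  simp only [Finsupp.single_apply]

end Strings

/-! ### The merging move and the potential that it increases. -/

theorem sum_three_pow_lt {ι : Type*} [Fintype ι] [DecidableEq ι] {l l' : ι → ℕ} {a b f : ι}
    (hab : a ≠ b) (haf : a ≠ f) (hbf : b ≠ f) (ha : l' a = l a + 1) (hf : l f = 0)
    (hba : l b ≤ l a) (h : ∀ c, c ≠ a → c ≠ b → c ≠ f → l' c = l c) :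
    ∑ c, 3 ^ l c < ∑ c, 3 ^ l' c := by
  have hsplit : ∀ g : ι → ℕ, ∑ c, g c =
      g a + (g b + (g f + ∑ c ∈ (((Finset.univ.erase a).erase b).erase f), g c)) := by
    intro g
    rw [Finset.add_sum_erase _ g (by simp [hbf.symm, haf.symm]),
      Finset.add_sum_erase _ g (by simp [hab.symm]), Finset.add_sum_erase _ g (by simp)]
  rw [hsplit, hsplit]
  have hrest : ∑ c ∈ (((Finset.univ.erase a).erase b).erase f), 3 ^ l' c =
      ∑ c ∈ (((Finset.univ.erase a).erase b).erase f), 3 ^ l c := by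
    refine Finset.sum_congr rfl fun c hc => ?_
    simp only [Finset.mem_erase] at hc
    rw [h c hc.2.2.1 hc.2.1 hc.1]
  -- Lengthening `a` gains `2 * 3 ^ l a`, which exceeds the loss on `b`, at most `3 ^ l b - 1`,
  -- however `b` is cut. This is why base 3 is used.
  have h1 : 3 ^ l b ≤ 3 ^ l a := Nat.pow_le_pow_right (by norm_num) hba
  have h2 : 0 < 3 ^ l a := by positivity
  have h3 : 0 < 3 ^ l' b := by positivity
  have h4 : 0 < 3 ^ l' f := by positivity
  rw [hrest, ha, hf, pow_succ]
  omega

namespace Strings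

variable {V ι K : Type*} [Field K] (S : Strings V ι)

/-- Moving one vertex `v` to the position `i` at either end of another string `a`; the part of the
string of `v` above `v` becomes a new string `f`. -/
theorem exists_merge [Fintype ι] [DecidableEq V] [DecidableEq ι] {q : K} {a f : ι} {v : V}
    (hav : a ≠ S.s v) (hlen : S.len (S.s v) ≤ S.len a) (hf : ∀ u, S.s u ≠ f) {i : ℤ}
    (hi : i = S.hi a ∨ i = S.lo a - 1)
    {y : ι → K} (hy : ∀ c, y c ≠ 0) (hvy : q ^ S.e v * y (S.s v) = q ^ i * y a) :
    ∃ (S' : Strings V ι) (y' : ι → K), (∀ c, y' c ≠ 0) ∧ S'.point q y' = S.point q y ∧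
      ∑ c, 3 ^ S.len c < ∑ c, 3 ^ S'.len c := by
  have hv1 := S.lo_le v
  have hv2 := S.lt_hi v
  have hb := S.len_eq (S.s v)
  have ha := S.len_eq a
  have hlf : S.hi f ≤ S.lo f := by
    by_contra h
    obtain ⟨u, hu, -⟩ := S.surj f (S.lo f) le_rfl (by omega)
    exact hf u hu
  have hfb : S.s v ≠ f := hf v
  -- The string `a` is at least as long as that of `v`, hence nonempty, while the unused label `f`
  -- has an empty interval.
  have hfa : a ≠ f := by
    rintro rfl
    omega
  generalize hbdef : S.s v = b at *
  -- The part of `b` below `v` keeps its label, and the part above keeps its positions and its scale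
  -- `y b` under the label `f`, so the point does not move. The `min` and `max` treat both ends of
  -- `a` at once.
  refine ⟨{
    s := fun u => if u = v then a else if S.s u = b ∧ S.e v < S.e u then f else S.s u
    e := fun u => if u = v then i else S.e u
    lo := fun c => if c = a then min (S.lo a) i else if c = f then S.e v + 1 else S.lo c
    hi := fun c => if c = a then max (S.hi a) (i + 1) else if c = b then S.e v
      else if c = f then S.hi b else S.hi c
    lo_le_hi := ?_
    lo_le := ?_
    lt_hi := ?_
    surj := ?_
    inj := ?_ }, fun c => if c = f then y b else y c, ?_, ?_, ?_⟩
  · intro c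
    have := S.lo_le_hi c
    grind
  · intro u
    have := S.lo_le u
    grind
  · intro u
    have := S.lt_hi u
    have := S.inj u v
    have : S.s u = b → S.e u = S.e v → u = v := by grind
    grind
  · intro c j h1 h2
    by_cases hca : c = a
    · subst hca
      by_cases hj : j = i
      · exact ⟨v, by simp, by simp [hj]⟩
      · obtain ⟨u, hu, hu'⟩ := S.surj c j (by grind) (by grind)
        exact ⟨u, by grind, by grind⟩
    · by_cases hcf : c = f
      · obtain ⟨u, hu, hu'⟩ := S.surj b j (by grind) (by grind)
        exact ⟨u, by grind, by grind⟩
      · obtain ⟨u, hu, hu'⟩ := S.surj c j (by grind) (by grind)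
        exact ⟨u, by grind, by grind⟩
  · intro u w h1 h2
    have := S.inj u w
    have := S.lo_le u
    have := S.lo_le w
    have := S.lt_hi u
    have := S.lt_hi w
    have := hf u
    have := hf w
    grind
  · intro c
    dsimp only
    split_ifs <;> exact hy _
  · funext u
    simp only [point]
    by_cases hu : u = v
    · subst hu
      simp [hfa, hbdef, hvy]
    · by_cases hu' : S.s u = b ∧ S.e v < S.e u
      · simp [hu, hu']
      · simp [hu, hu', hf u]
  · refine sum_three_pow_lt hav hfa hfb ?_ (by simp [len, hlf]) hlen ?_
    · have := S.lo_le_hi a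
      simp only [len, if_true]
      omega
    · intro c h1 h2 h3
      simp [len, h1, h2, h3]

end Strings

/-! ### Linear factors forced by wheels and by merging. -/

/-- The wheel conditions for a polynomial, at all points of the torus. -/
def PolyWheel {V K : Type*} [Field K] (q t : K) (p : MvPolynomial V K) : Prop :=
  ∀ x : V → K, (∀ v, x v ≠ 0) → ∀ u v w : V, x v = q * x u →
    (x w = t * x u ∨ t * x w = q * x u) → eval x p = 0

namespace Strings

variable {V ι K : Type*} [Field K] (S : Strings V ι)

/-- The positions of the string `a` (except the last), with a sign: the wheels on a pair of
consecutive vertices. -/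
def wheelSet (a : ι) : Finset (ℤ × Bool) := Finset.Ico (S.lo a) (S.hi a - 1) ×ˢ Finset.univ

theorem card_wheelSet (a : ι) : (S.wheelSet a).card = 2 * (S.len a - 1) := by
  rw [wheelSet, Finset.card_product, Int.card_Ico, Finset.card_univ, Fintype.card_bool, mul_comm,
    len]
  congr 1
  omega

variable [Fintype V] [DecidableEq ι]

/-- The product of the factors of a specialization that come from the wheel conditions. -/
def wheelFactor (q t : K) (a b : ι) : MvPolynomial ι K :=
  ∏ v ∈ S.fiber b, ∏ x ∈ S.wheelSet a,
    lin a b (q ^ S.e v) (q ^ (bif x.2 then x.1 else x.1 + 1) * t ^ (bif x.2 then 1 else -1 : ℤ))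

/-- The product of the factors of a specialization that come from the vanishing of the
specializations with longer strings. -/
def mergeFactor (q t : K) (a b : ι) : MvPolynomial ι K :=
  ∏ x ∈ S.fiber b ×ˢ (Finset.univ : Finset Bool),
    lin a b (q ^ S.e x.1) (q ^ (bif x.2 then S.hi a else S.lo a - 1) * t ^ (0 : ℤ))

variable {q t : K} {a b : ι}

theorem hasPairDegree_wheelFactor (h : Generic q t) (hab : a ≠ b) :
    HasPairDegree a b (S.len b * (2 * (S.len a - 1))) (S.wheelFactor q t a b) := by
  have := HasPairDegree.prod (a := a) (b := b) (S.fiber b) fun v _ =>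
    HasPairDegree.prod (S.wheelSet a) fun x _ =>
      hasPairDegree_lin hab (h.zpow_ne (S.e v)) (h.mul_ne (bif x.2 then x.1 else x.1 + 1)
        (bif x.2 then 1 else -1 : ℤ))
  rwa [card_wheelSet, card_fiber, mul_one] at this

theorem hasPairDegree_mergeFactor (h : Generic q t) (hab : a ≠ b) :
    HasPairDegree a b (S.len b * 2) (S.mergeFactor q t a b) := by
  have := HasPairDegree.prod (a := a) (b := b) (S.fiber b ×ˢ (Finset.univ : Finset Bool))
    fun x _ => hasPairDegree_lin hab (h.zpow_ne (S.e x.1))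
      (h.mul_ne (bif x.2 then S.hi a else S.lo a - 1) 0)
  rwa [Finset.card_product, card_fiber, Finset.card_univ, Fintype.card_bool, mul_one] at this

/-- The power of `t` separates the two kinds: it is `±1` for wheels and `0` for merges. -/
theorem isRelPrime_wheelFactor_mergeFactor (h : Generic q t) (hab : a ≠ b) :
    IsRelPrime (S.wheelFactor q t a b) (S.mergeFactor q t a b) := by
  refine IsRelPrime.prod_left fun v _ => IsRelPrime.prod_left fun x _ =>
    IsRelPrime.prod_right fun y _ => h.isRelPrime_lin hab (Or.inr ?_)
  cases x.2 <;> simp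

/-- No factor repeats: the two target positions are `l_a + 1` apart, while positions on `b` differ
by at most `l_b - 1 < l_a + 1`. This is where the longer string has to come first. -/
theorem mergeFactor_dvd (h : Generic q t) (hab : a ≠ b) (hlen : S.len b ≤ S.len a)
    {f : MvPolynomial ι K}
    (hf : ∀ v, S.s v = b → ∀ i, (i = S.hi a ∨ i = S.lo a - 1) → ∀ y : ι → K, (∀ c, y c ≠ 0) →
      q ^ S.e v * y b = q ^ i * y a → eval y f = 0) :
    S.mergeFactor q t a b ∣ f := by
  have := h.infinite
  have h1 := S.len_eq a
  have h2 := S.len_eq b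
  refine h.prod_lin_dvd hab (e := fun x : V × Bool => S.e x.1) (j := fun _ => 0)
    (i := fun x => bif x.2 then S.hi a else S.lo a - 1) ?_ ?_
  · rintro ⟨v, x⟩ hv ⟨w, y⟩ hw hne
    left
    simp only [Finset.mem_product, mem_fiber, Finset.mem_univ, and_true] at hv hw
    have hv1 := S.lo_le v
    have hv2 := S.lt_hi v
    have hw1 := S.lo_le w
    have hw2 := S.lt_hi w
    have := S.inj v w (hv.trans hw.symm)
    rw [hv] at hv1 hv2
    rw [hw] at hw1 hw2
    cases x <;> cases y <;> simp at hne ⊢ <;> grind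
  · rintro ⟨v, x⟩ hv
    simp only [Finset.mem_product, mem_fiber, Finset.mem_univ, and_true] at hv
    refine lin_dvd_of_eval_eq_zero hab (h.zpow_ne _) (h.mul_ne _ _) fun y hy hvy => ?_
    refine hf v hv _ ?_ y hy (by simpa using hvy)
    cases x <;> simp

/-- Different vertices of `b` can give proportional forms in `y_a, y_b`, so divisibility with
multiplicity cannot be read off after specialization. The vertices of `b` are therefore first kept
as independent variables (`A`), where the forms are coprime, and only then put on the string (`B`).
-/
theorem wheelFactor_dvd (h : Generic q t) (hab : a ≠ b) {p : MvPolynomial V K}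
    (hp : PolyWheel q t p) : S.wheelFactor q t a b ∣ S.spec q p := by
  classical
  have := h.infinite
  let A : MvPolynomial V K →ₐ[K] MvPolynomial (ι ⊕ V) K :=
    aeval fun v => if S.s v = b then X (Sum.inr v) else C (q ^ S.e v) * X (Sum.inl (S.s v))
  let B : MvPolynomial (ι ⊕ V) K →ₐ[K] MvPolynomial ι K :=
    aeval (Sum.elim X fun v => C (q ^ S.e v) * X b)
  have hBA : B (A p) = S.spec q p := by
    have : B.comp A = S.spec q := by
      apply algHom_ext
      intro v
      by_cases hv : S.s v = b
      · simp [A, B, spec, hv]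
      · simp [A, B, spec, hv]
    exact DFunLike.congr_fun this p
  have hA : ∀ y : ι ⊕ V → K, eval y (A p) = eval (fun v =>
      if S.s v = b then y (Sum.inr v) else q ^ S.e v * y (Sum.inl (S.s v))) p := by
    intro y
    have : (aeval y).comp A = aeval (fun v =>
        if S.s v = b then y (Sum.inr v) else q ^ S.e v * y (Sum.inl (S.s v))) := by
      apply algHom_ext
      intro v
      by_cases hv : S.s v = b
      · simp [A, hv]
      · simp [A, hv]
    simpa [aeval_eq_eval] using DFunLike.congr_fun this p
  have hdvd : ∏ v ∈ S.fiber b, ∏ x ∈ S.wheelSet a, lin (Sum.inl a) (Sum.inr v) (q ^ (0 : ℤ))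
      (q ^ (bif x.2 then x.1 else x.1 + 1) * t ^ (bif x.2 then 1 else -1 : ℤ)) ∣ A p := by
    have hdeg := fun v : V => HasPairDegree.prod (a := Sum.inl a) (b := Sum.inr v) (S.wheelSet a)
      fun x _ => hasPairDegree_lin Sum.inl_ne_inr (h.zpow_ne 0)
        (h.mul_ne (bif x.2 then x.1 else x.1 + 1) (bif x.2 then 1 else -1 : ℤ))
    refine Finset.prod_dvd_of_isRelPrime ?_ ?_
    · intro v _ w _ hvw
      refine IsRelPrime.prod_left fun x _ => isRelPrime_lin_of_pair Sum.inl_ne_inr (h.zpow_ne _)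
        (h.mul_ne _ _) (hdeg w) ?_
      simp [hvw]
    · intro v hv
      rw [mem_fiber] at hv
      refine h.prod_lin_dvd Sum.inl_ne_inr (e := fun _ => 0)
        (i := fun x : ℤ × Bool => bif x.2 then x.1 else x.1 + 1)
        (j := fun x => bif x.2 then 1 else -1) ?_ ?_
      · rintro ⟨i, x⟩ - ⟨j, y⟩ - hne
        cases x <;> cases y <;> simp at hne ⊢ <;> omega
      · rintro ⟨i, x⟩ hx
        simp only [wheelSet, Finset.mem_product, Finset.mem_Ico, Finset.mem_univ, and_true] at hx
        obtain ⟨u, hu, hui⟩ := S.surj a i hx.1 (by omega)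
        obtain ⟨u', hu', hui'⟩ := S.surj a (i + 1) (by omega) (by omega)
        refine lin_dvd_of_eval_eq_zero Sum.inl_ne_inr (h.zpow_ne _) (h.mul_ne _ _)
          fun y hy hvy => ?_
        rw [hA]
        refine hp _ (fun w => ?_) u u' v ?_ ?_
        · split_ifs
          exacts [hy _, mul_ne_zero (h.zpow_ne _) (hy _)]
        · rw [hu, hu', if_neg hab, if_neg hab, hui, hui', zpow_add_one₀ h.q_ne_zero]
          ring
        · rw [hu, hv, if_pos rfl, if_neg hab, hui]
          rw [zpow_zero, one_mul] at hvy
          rw [hvy]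
          have := h.t_ne_zero
          cases x
          · right
            simp only [cond_false, zpow_add_one₀ h.q_ne_zero, zpow_neg_one]
            field_simp
          · left
            simp only [cond_true, zpow_one]
            ring
  have := map_dvd B hdvd
  rw [hBA, map_prod] at this
  rw [wheelFactor]
  convert this using 2 with v _
  rw [map_prod]
  refine Finset.prod_congr rfl fun x _ => ?_
  simp [lin, B]

end Strings

/-! ### The degree count for the cofactor. -/

theorem totalDegree_prod_of_hasPairDegree {ι K : Type*} [Field K] [DecidableEq ι]
    {s : Finset (ι × ι)} {k : ι × ι → ℕ} {F : ι × ι → MvPolynomial ι K}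
    (h : ∀ x ∈ s, HasPairDegree x.1 x.2 (k x) (F x)) :
    (∏ x ∈ s, F x).totalDegree = ∑ x ∈ s, k x := by
  induction s using Finset.induction_on with
  | empty => simp
  | insert x s hx ih =>
    rw [Finset.prod_insert hx, Finset.sum_insert hx, totalDegree_mul_of_isDomain
      (h x (by simp)).1 (Finset.prod_ne_zero_iff.2 fun y hy => (h y (by simp [hy])).1),
      ih fun y hy => h y (by simp [hy]), (h x (by simp)).2.1]

theorem degreeOf_prod_of_hasPairDegree {ι K : Type*} [Field K] [DecidableEq ι]
    {s : Finset (ι × ι)} {k : ι × ι → ℕ} {F : ι × ι → MvPolynomial ι K}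
    (h : ∀ x ∈ s, HasPairDegree x.1 x.2 (k x) (F x)) (c : ι) :
    degreeOf c (∏ x ∈ s, F x) = ∑ x ∈ s, if c = x.1 ∨ c = x.2 then k x else 0 := by
  rw [degreeOf_prod_eq _ _ fun x hx => (h x hx).1]
  exact Finset.sum_congr rfl fun x hx => (h x hx).2.2 c

/-- The slope conditions on a polynomial, with strict inequalities for proper subsets of the
variables. -/
structure StrictSlope {V K : Type*} [Fintype V] [Field K] (n : ℕ) (M : ℤ)
    (p : MvPolynomial V K) : Prop where
  lt : ∀ d ∈ p.support, ∀ I : Finset V, 0 < I.card → I.card < Fintype.card V →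
    n * ∑ v ∈ I, (d v : ℤ) < M * I.card + n * (I.card * (2 * Fintype.card V - I.card - 1))
  eq : ∀ d ∈ p.support, n * ∑ v, (d v : ℤ) =
    M * Fintype.card V + n * (Fintype.card V * (Fintype.card V - 1))

namespace Strings

variable {V ι K : Type*} [Field K] [Fintype ι] [LinearOrder ι] (S : Strings V ι)

/-- The pairs of strings, the longer one first. -/
def pairs : Finset (ι × ι) :=
  Finset.univ.filter fun x => S.len x.2 < S.len x.1 ∨ S.len x.1 = S.len x.2 ∧ x.1 < x.2

theorem mem_pairs {x : ι × ι} :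
    x ∈ S.pairs ↔ S.len x.2 < S.len x.1 ∨ S.len x.1 = S.len x.2 ∧ x.1 < x.2 := by
  simp [pairs]

theorem ne_of_mem_pairs {x : ι × ι} (hx : x ∈ S.pairs) : x.1 ≠ x.2 := by
  rw [mem_pairs] at hx
  intro h
  rw [h] at hx
  simp at hx

variable [Fintype V]

/-- Each other string `b` is paired with `c` exactly once, ties in length being broken by the order
on labels, and the other lengths add up to `N - l_c`. -/
theorem sum_pairs (c : ι) :
    ∑ x ∈ S.pairs, (if c = x.1 ∨ c = x.2 then 2 * (S.len x.1 * S.len x.2) else 0) +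
      2 * (S.len c * S.len c) = 2 * (S.len c * Fintype.card V) := by
  -- Split by which component of the pair equals `c`; both cannot, since a string is not paired with
  -- itself.
  have h1 : ∀ a b : ι, (if (a, b) ∈ S.pairs then
      (if c = a ∨ c = b then 2 * (S.len a * S.len b) else 0) else 0) =
      (if a = c then (if (c, b) ∈ S.pairs then 2 * (S.len c * S.len b) else 0) else 0) +
      (if b = c then (if (a, c) ∈ S.pairs then 2 * (S.len c * S.len a) else 0) else 0) := by
    intro a b
    have := fun h => S.ne_of_mem_pairs (x := (a, b)) h
    by_cases ha : a = c
    · subst ha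
      by_cases hb : b = a
      · subst hb
        simp at this
        simp [this]
      · simp [hb]
    · by_cases hb : b = c
      · subst hb
        simp [ha, mul_comm]
      · simp [ha, hb, Ne.symm ha, Ne.symm hb]
  have h2 : ∑ x ∈ S.pairs, (if c = x.1 ∨ c = x.2 then 2 * (S.len x.1 * S.len x.2) else 0) =
      ∑ b, if b = c then 0 else 2 * (S.len c * S.len b) := by
    rw [← Finset.sum_ite_mem_eq, Fintype.sum_prod_type]
    simp_rw [h1, Finset.sum_add_distrib]
    rw [Finset.sum_comm]
    simp only [Finset.sum_ite_eq', Finset.mem_univ, if_true]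
    rw [← Finset.sum_add_distrib]
    refine Finset.sum_congr rfl fun b _ => ?_
    simp only [mem_pairs]
    rcases lt_trichotomy b c with h | h | h
    · have := h.ne
      have := h.not_gt
      split_ifs <;> grind
    · subst h
      simp
    · have := h.ne'
      have := h.not_gt
      split_ifs <;> grind
  rw [h2, ← S.sum_len, Finset.mul_sum, Finset.mul_sum,
    ← Finset.add_sum_erase Finset.univ _ (Finset.mem_univ c),
    ← Finset.add_sum_erase Finset.univ (fun a => 2 * (S.len c * S.len a)) (Finset.mem_univ c),
    if_pos rfl, zero_add, add_comm]
  congr 1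
  refine Finset.sum_congr rfl fun b hb => ?_
  rw [if_neg (Finset.ne_of_mem_erase hb)]

/-- A top-degree monomial of the cofactor has exponents strictly below bounds whose sum is its total
degree. -/
theorem eq_zero_of_spec_eq_mul {n : ℕ} {M : ℤ} {p : MvPolynomial V K}
    (hp : StrictSlope n M p) {q : K} [Nonempty V] (hlen : ∀ a, S.len a < Fintype.card V)
    {F : ι × ι → MvPolynomial ι K}
    (hF : ∀ x ∈ S.pairs, HasPairDegree x.1 x.2 (2 * (S.len x.1 * S.len x.2)) (F x))
    (hdvd : ∏ x ∈ S.pairs, F x ∣ S.spec q p) : S.spec q p = 0 := by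
  by_contra hne
  obtain ⟨g, hg⟩ := hdvd
  have hP0 := left_ne_zero_of_mul (hg ▸ hne)
  have hg0 := right_ne_zero_of_mul (hg ▸ hne)
  set P := ∏ x ∈ S.pairs, F x
  set N : ℤ := ((Fintype.card V : ℕ) : ℤ) with hN
  have hPtot := totalDegree_prod_of_hasPairDegree hF
  have hPdeg := fun c => degreeOf_prod_of_hasPairDegree hF c
  -- the handshake relation between the total degree and the partial degrees
  have hshake : ∑ c, degreeOf c P = 2 * P.totalDegree := by
    rw [hPtot, Finset.mul_sum]
    simp_rw [P, hPdeg]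
    rw [Finset.sum_comm]
    refine Finset.sum_congr rfl fun x hx => ?_
    have hx' := S.ne_of_mem_pairs hx
    have : ∀ c, (if c = x.1 ∨ c = x.2 then 2 * (S.len x.1 * S.len x.2) else 0) =
        (if c = x.1 then 2 * (S.len x.1 * S.len x.2) else 0) +
        (if c = x.2 then 2 * (S.len x.1 * S.len x.2) else 0) := by
      intro c
      by_cases h1 : c = x.1
      · subst h1; simp [hx']
      · simp [h1]
    simp_rw [this, Finset.sum_add_distrib]
    simp
    ring
  have hPdeg' : ∀ c, (degreeOf c P : ℤ) = 2 * (S.len c * (N - S.len c)) := by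
    intro c
    have := S.sum_pairs c
    rw [← hPdeg] at this
    zify at this
    linear_combination this
  have hsumlen : ∑ c, (S.len c : ℤ) = N := by
    have := S.sum_len
    zify at this
    exact this
  -- the total degree of the cofactor
  obtain ⟨d, hd, hdtot⟩ : ∃ d ∈ g.support, (∑ c, (d c : ℤ)) = g.totalDegree := by
    obtain ⟨d, hd, h⟩ := Finset.exists_mem_eq_sup g.support (support_nonempty.2 hg0)
      fun d => d.sum fun _ e => e
    refine ⟨d, hd, ?_⟩
    rw [totalDegree, h, Finsupp.sum_fintype _ _ (by simp)]
    push_cast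
    rfl
  -- By homogeneity any monomial of `p` computes the total degree.
  have hspectot : (n : ℤ) * (S.spec q p).totalDegree = M * N + n * (N * (N - 1)) := by
    obtain ⟨d, hd, h⟩ := Finset.exists_mem_eq_sup (S.spec q p).support (support_nonempty.2 hne)
      fun d => d.sum fun _ e => e
    obtain ⟨m, hm, hmd⟩ := S.exists_of_mem_support_spec hd
    rw [totalDegree, h, Finsupp.sum_fintype _ _ (by simp), ← hp.eq m hm]
    simp_rw [hmd]
    congr 1
    push_cast
    simp_rw [fiber]
    exact Finset.sum_fiberwise _ _ _
  have htot : (S.spec q p).totalDegree = P.totalDegree + g.totalDegree := by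
    rw [hg, totalDegree_mul_of_isDomain hP0 hg0]
  -- the partial degrees of the cofactor
  have hle : ∀ c, (n : ℤ) * d c ≤ M * S.len c + n * (S.len c * (S.len c - 1)) ∧
      (0 < S.len c → (n : ℤ) * d c < M * S.len c + n * (S.len c * (S.len c - 1))) := by
    intro c
    have h1 : d c ≤ degreeOf c g := monomial_le_degreeOf c hd
    have h2 : degreeOf c (S.spec q p) = degreeOf c P + degreeOf c g := by
      rw [hg, degreeOf_mul_eq hP0 hg0]
    obtain ⟨d', hd', h3⟩ := Finset.exists_mem_eq_sup (S.spec q p).support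
      (support_nonempty.2 hne) fun d => d c
    rw [← degreeOf_eq_sup] at h3
    obtain ⟨m, hm, hmd⟩ := S.exists_of_mem_support_spec hd'
    have h4 : (d c : ℤ) + 2 * (S.len c * (N - S.len c)) ≤ ∑ v ∈ S.fiber c, (m v : ℤ) := by
      rw [← hPdeg', ← Nat.cast_sum, ← hmd]
      have : d c + degreeOf c P ≤ d' c := by omega
      exact_mod_cast this
    -- A label without vertices has exponent `0`, equal to its bound, so strictness is available
    -- only on nonempty strings; one of those suffices below.
    rcases Nat.eq_zero_or_pos (S.len c) with h0 | h0
    · have : S.fiber c = ∅ := by rw [← Finset.card_eq_zero, card_fiber, h0]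
      rw [this, h0] at h4
      simp at h4
      simp [h0, h4]
    · have h5 := hp.lt m hm (S.fiber c) (by rwa [card_fiber]) (by rw [card_fiber]; exact hlen c)
      rw [card_fiber, ← hN] at h5
      have h6 := mul_le_mul_of_nonneg_left h4 (Int.natCast_nonneg n)
      have h7 : (n : ℤ) * d c < M * S.len c + n * (S.len c * (S.len c - 1)) := by
        linarith
      exact ⟨h7.le, fun _ => h7⟩
  obtain ⟨v⟩ := ‹Nonempty V›
  have hlt := Finset.sum_lt_sum (fun c (_ : c ∈ Finset.univ) => (hle c).1)
    ⟨S.s v, Finset.mem_univ _, (hle _).2 S.len_pos_of_mem⟩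
  rw [← Finset.mul_sum, hdtot, Finset.sum_add_distrib, ← Finset.mul_sum, ← Finset.mul_sum,
    hsumlen] at hlt
  have hs2 : 2 * (P.totalDegree : ℤ) = 2 * (N * N) - 2 * ∑ c, (S.len c : ℤ) * S.len c := by
    have : ((∑ c, degreeOf c P : ℕ) : ℤ) = 2 * P.totalDegree := by rw [hshake]; push_cast; rfl
    rw [← this]
    push_cast
    simp_rw [hPdeg', mul_sub, Finset.sum_sub_distrib, ← Finset.mul_sum, ← Finset.sum_mul, hsumlen]
  have hs3 : ∑ c, (S.len c : ℤ) * (S.len c - 1) = ∑ c, (S.len c : ℤ) * S.len c - N := by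
    simp_rw [mul_sub, mul_one, Finset.sum_sub_distrib, hsumlen]
  rw [htot] at hspectot
  push_cast at hspectot
  rw [hs3] at hlt
  have hs4 : (P.totalDegree : ℤ) = N * N - ∑ c, (S.len c : ℤ) * S.len c := by linarith
  rw [hs4] at hspectot
  linarith

end Strings

/-! ### Induction over all decompositions into strings. -/

namespace Strings

variable {V ι K : Type*} [Field K] [Fintype V] [LinearOrder ι]

/-- The decomposition into strings with a single vertex. -/
def discrete (f : V ↪ ι) : Strings V ι where
  s := f
  e _ := 0
  lo _ := 0
  hi a := if a ∈ Finset.univ.map f then 1 else 0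
  lo_le_hi a := by split_ifs <;> simp
  lo_le v := le_rfl
  lt_hi v := by simp
  surj a i h1 h2 := by
    split_ifs at h2 with ha
    · obtain ⟨v, -, hv⟩ := Finset.mem_map.1 ha
      exact ⟨v, hv, by omega⟩
    · omega
  inj u v h _ := f.injective h

theorem spec_discrete (f : V ↪ ι) (q : K) (p : MvPolynomial V K) :
    (discrete f).spec q p = rename f p := by
  have : (discrete f).spec q = rename f := by
    apply algHom_ext
    intro v
    simp [spec, discrete]
  rw [this]

variable [Fintype ι] (S : Strings V ι)

theorem sum_three_pow_le : ∑ c, 3 ^ S.len c ≤ Fintype.card ι * 3 ^ Fintype.card V := by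
  rw [← smul_eq_mul, ← Finset.card_univ, ← Finset.sum_const]
  refine Finset.sum_le_sum fun c _ => Nat.pow_le_pow_right (by norm_num) ?_
  rw [← card_fiber]
  exact Finset.card_le_univ _

/-- All specializations of `p` to strings vanish. -/
theorem spec_eq_zero (hcard : Fintype.card V < Fintype.card ι) [Nonempty V] {q t : K}
    (h : Generic q t) {n : ℕ} {M : ℤ} {p : MvPolynomial V K} (hp : StrictSlope n M p)
    (hw : PolyWheel q t p)
    (hbase : ∀ (e : V → ℤ) (lo : ℤ), Function.Injective e →
      (∀ v, lo ≤ e v ∧ e v < lo + Fintype.card V) → ∀ y : K, y ≠ 0 →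
      eval (fun v => q ^ e v * y) p = 0) :
    S.spec q p = 0 := by
  classical
  have hinf := h.infinite
  -- The potential is bounded by `sum_three_pow_le`, so its distance from that bound decreases with
  -- every merge.
  induction hk : Fintype.card ι * 3 ^ Fintype.card V - ∑ c, 3 ^ S.len c using
    Nat.strong_induction_on generalizing S with
  | _ k ih =>
  by_cases hlen : ∀ a, S.len a < Fintype.card V
  · refine S.eq_zero_of_spec_eq_mul hp hlen
      (F := fun x => S.wheelFactor q t x.1 x.2 * S.mergeFactor q t x.1 x.2) ?_ ?_
    · intro x hx
      have hne := S.ne_of_mem_pairs hx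
      have := (S.hasPairDegree_wheelFactor h hne).mul (S.hasPairDegree_mergeFactor h hne)
      convert this using 1
      rw [mem_pairs] at hx
      -- `2 (l_a - 1) l_b + 2 l_b = 2 l_a l_b` survives truncated subtraction because an empty
      -- longer string forces the shorter one to be empty.
      rcases Nat.eq_zero_or_pos (S.len x.1) with h0 | h0
      · have : S.len x.2 = 0 := by omega
        simp [h0, this]
      · obtain ⟨l, hl⟩ := Nat.exists_eq_succ_of_ne_zero h0.ne'
        rw [hl, Nat.succ_eq_add_one, Nat.add_sub_cancel]
        ring
    · refine Finset.prod_dvd_of_isRelPrime ?_ ?_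
      · intro x hx y hy hxy
        have hnx := S.ne_of_mem_pairs hx
        have hny := S.ne_of_mem_pairs hy
        have hpair : ¬((x.1 = y.1 ∨ x.1 = y.2) ∧ (x.2 = y.1 ∨ x.2 = y.2)) := by
          rintro ⟨h1 | h1, h2 | h2⟩
          · exact hnx (h1.trans h2.symm)
          · exact hxy (Prod.ext h1 h2)
          · rw [Finset.mem_coe, mem_pairs] at hx hy
            rw [h1, h2] at hx
            rcases hx with hx | hx <;> rcases hy with hy | hy
            · omega
            · omega
            · omega
            · exact lt_asymm hx.2 hy.2
          · exact hnx (h1.trans h2.symm)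
        have hd := (S.hasPairDegree_wheelFactor h hny).mul (S.hasPairDegree_mergeFactor h hny)
        exact IsRelPrime.mul_left
          (IsRelPrime.prod_left fun v _ => IsRelPrime.prod_left fun z _ =>
            isRelPrime_lin_of_pair hnx (h.zpow_ne _) (h.mul_ne _ _) hd hpair)
          (IsRelPrime.prod_left fun z _ =>
            isRelPrime_lin_of_pair hnx (h.zpow_ne _) (h.mul_ne _ _) hd hpair)
      · intro x hx
        have hne := S.ne_of_mem_pairs hx
        have hle : S.len x.2 ≤ S.len x.1 := by
          rw [mem_pairs] at hx
          omega
        refine (S.isRelPrime_wheelFactor_mergeFactor h hne).mul_dvd (S.wheelFactor_dvd h hne hw)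
          (S.mergeFactor_dvd h hne hle ?_)
        intro v hv i hi y hy hvy
        -- There are more labels than vertices, so one is free for the piece cut off.
        obtain ⟨f, hf⟩ : ∃ f, ∀ u, S.s u ≠ f := by
          by_contra! hcon
          exact absurd (Fintype.card_le_of_surjective S.s hcon) (by omega)
        rw [← hv] at hne hle hvy
        obtain ⟨S', y', hy', hpt, hlt⟩ := S.exists_merge hne hle hf hi hy hvy
        have h1 := S'.sum_three_pow_le
        have := ih _ (by omega) S' rfl
        rw [eval_spec, ← hpt, ← eval_spec, this, map_zero]
  -- A string of length `N` contains every vertex: this is the base case.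
  · push Not at hlen
    obtain ⟨a, ha⟩ := hlen
    have hall : ∀ v, S.s v = a := by
      intro v
      rw [← S.mem_fiber, (Finset.card_eq_iff_eq_univ (S.fiber a)).1
        (le_antisymm (Finset.card_le_univ _) (by rwa [card_fiber]))]
      exact Finset.mem_univ v
    have hla : S.len a = Fintype.card V :=
      le_antisymm (by rw [← card_fiber]; exact Finset.card_le_univ _) ha
    refine funext_set (fun _ => {0}ᶜ) (fun _ => (Set.finite_singleton 0).infinite_compl) ?_
    intro y hy
    rw [eval_spec, map_zero]
    have := hbase S.e (S.lo a) (fun u v huv => S.inj u v ((hall u).trans (hall v).symm) huv)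
      (fun v => by
        have h1 := S.lo_le v
        have h2 := S.lt_hi v
        have h3 := S.len_eq a
        rw [hall v] at h1 h2
        omega) (y a) (hy a trivial)
    have hpt : S.point q y = fun v => q ^ S.e v * y a := by
      funext v
      rw [point, hall v]
    rwa [hpt]

end Strings

/-- A polynomial satisfying the wheel conditions and the strict slope conditions vanishes as soon
as its specializations to a single string vanish. -/
theorem eq_zero_of_strictSlope {N : ℕ} (hN : 0 < N) {K : Type*} [Field K] {q t : K}
    (h : Generic q t) {n : ℕ} {M : ℤ} {p : MvPolynomial (Fin N) K} (hp : StrictSlope n M p)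
    (hw : PolyWheel q t p)
    (hbase : ∀ (e : Fin N → ℤ) (lo : ℤ), Function.Injective e →
      (∀ v, lo ≤ e v ∧ e v < lo + N) → ∀ y : K, y ≠ 0 →
      eval (fun v => q ^ e v * y) p = 0) :
    p = 0 := by
  have : Nonempty (Fin N) := ⟨⟨0, hN⟩⟩
  -- Labels in `Fin (N + 1)` provide the spare one; this specialization only renames variables, so
  -- its vanishing gives `p = 0`.
  have := (Strings.discrete (Fin.castSuccEmb (n := N))).spec_eq_zero (by simp) h hp hw
    (by simpa using hbase)
  rw [Strings.spec_discrete] at this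
  exact (rename_injective _ (Fin.castSuccEmb (n := N)).injective) (by simpa using this)

/-- Distinct monomials in two polynomial variables are different; negative exponents are first
cleared by a common shift `A`. -/
theorem generic_q_t : Generic q t := by
  have hinj := IsFractionRing.injective (MvPolynomial (Fin 2) ℚ) 𝕂
  have hq : q ≠ 0 := by
    rw [q, Ne, map_eq_zero_iff _ hinj]
    exact X_ne_zero 0
  have ht : t ≠ 0 := by
    rw [t, Ne, map_eq_zero_iff _ hinj]
    exact X_ne_zero 1
  have hnat : ∀ i j k l : ℕ, q ^ i * t ^ j = q ^ k * t ^ l → i = k ∧ j = l := by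
    intro i j k l h
    simp only [q, t, ← map_pow, ← map_mul] at h
    have := hinj h
    rw [X_pow_eq_monomial, X_pow_eq_monomial, X_pow_eq_monomial, X_pow_eq_monomial, monomial_mul,
      monomial_mul, monomial_eq_monomial_iff] at this
    simp only [mul_one, one_ne_zero, and_false, or_false, and_true] at this
    have h0 := DFunLike.congr_fun this 0
    have h1 := DFunLike.congr_fun this 1
    simp at h0 h1
    exact ⟨h0, h1⟩
  refine ⟨hq, ht, fun i j k l h => ?_⟩
  obtain ⟨A, hA⟩ : ∃ A : ℕ, 0 ≤ i + A ∧ 0 ≤ j + A ∧ 0 ≤ k + A ∧ 0 ≤ l + A :=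
    ⟨i.natAbs + j.natAbs + k.natAbs + l.natAbs, by omega⟩
  have h' : q ^ (i + A) * t ^ (j + A) = q ^ (k + A) * t ^ (l + A) := by
    rw [zpow_add₀ hq, zpow_add₀ hq, zpow_add₀ ht, zpow_add₀ ht]
    linear_combination (q ^ (A : ℤ) * t ^ (A : ℤ)) * h
  obtain ⟨h1, h2, h3, h4⟩ := hA
  rw [← Int.toNat_of_nonneg h1, ← Int.toNat_of_nonneg h2, ← Int.toNat_of_nonneg h3,
    ← Int.toNat_of_nonneg h4] at h'
  simp only [zpow_natCast] at h'
  have := hnat _ _ _ _ h'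
  omega

/-! ### Degrees in `ξ` and exponents of numerators. -/

section Scale

variable {N : ℕ}

/-- The substitution `z_i ↦ ξ z_i` for `i ∈ I`, with values in polynomials in `ξ`. -/
def scaleHom (I : Finset (Fin N)) : Poly N →ₐ[𝕂] Polynomial (RatFn N) :=
  aeval fun i => if i ∈ I then Polynomial.X * Polynomial.C (z i) else Polynomial.C (z i)

theorem scale_injective (I : Finset (Fin N)) : Function.Injective (scale I) :=
  (scale I).toRingHom.injective

theorem scale_algebraMap (I : Finset (Fin N)) (p : Poly N) :
    scale I (algebraMap (Poly N) (RatFn N) p) =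
      algebraMap (Polynomial (RatFn N)) (RatFunc (RatFn N)) (scaleHom I p) := by
  have h1 : scale I (algebraMap (Poly N) (RatFn N) p) = scalePoly I p :=
    IsFractionRing.lift_algebraMap (scalePoly_injective I) p
  have h2 : scalePoly I = (IsScalarTower.toAlgHom 𝕂 (Polynomial (RatFn N))
      (RatFunc (RatFn N))).comp (scaleHom I) := by
    apply algHom_ext
    intro i
    simp only [scalePoly, scaleHom, aeval_X, AlgHom.comp_apply, IsScalarTower.coe_toAlgHom']
    split_ifs <;> simp only [map_mul, RatFunc.algebraMap_X, RatFunc.algebraMap_C]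
  rw [h1, h2]
  rfl

theorem scaleHom_injective (I : Finset (Fin N)) : Function.Injective (scaleHom I) := by
  intro a b h
  have := congrArg (algebraMap (Polynomial (RatFn N)) (RatFunc (RatFn N))) h
  rw [← scale_algebraMap, ← scale_algebraMap] at this
  exact IsFractionRing.injective (Poly N) (RatFn N) (scale_injective I this)

theorem scaleHom_monomial (I : Finset (Fin N)) (d : Fin N →₀ ℕ) (c : 𝕂) :
    scaleHom I (monomial d c) = Polynomial.monomial (∑ v ∈ I, d v)
      (algebraMap (Poly N) (RatFn N) (monomial d c)) := by
  have h1 : ∀ i, (if i ∈ I then Polynomial.X * Polynomial.C (z i) else Polynomial.C (z i)) =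
      (Polynomial.X : Polynomial (RatFn N)) ^ (if i ∈ I then 1 else 0) * Polynomial.C (z i) := by
    intro i
    split_ifs <;> simp
  rw [scaleHom, aeval_monomial, Finsupp.prod_fintype _ _ (by simp)]
  simp_rw [h1, mul_pow, Finset.prod_mul_distrib, ← pow_mul, Finset.prod_pow_eq_pow_sum, ite_mul,
    one_mul, zero_mul, Finset.sum_ite_mem, Finset.univ_inter]
  rw [← Polynomial.C_mul_X_pow_eq_monomial, monomial_eq, map_mul, Polynomial.C_mul,
    Finsupp.prod_fintype _ _ (by simp), map_prod]
  simp only [map_pow, map_prod]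
  rw [← MvPolynomial.algebraMap_eq, ← IsScalarTower.algebraMap_apply,
    ← Polynomial.algebraMap_eq, ← IsScalarTower.algebraMap_apply]
  simp only [z, Polynomial.algebraMap_eq]
  ring

/-- Scaling keeps the variables `z_i`, so monomials with the same power of `ξ` remain independent
and cannot cancel. -/
theorem coeff_scaleHom_ne_zero (I : Finset (Fin N)) {p : Poly N} {d : Fin N →₀ ℕ}
    (hd : d ∈ p.support) : (scaleHom I p).coeff (∑ v ∈ I, d v) ≠ 0 := by
  classical
  have h : (scaleHom I p).coeff (∑ v ∈ I, d v) = algebraMap (Poly N) (RatFn N)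
      (∑ m ∈ p.support with ∑ v ∈ I, m v = ∑ v ∈ I, d v, monomial m (coeff m p)) := by
    conv_lhs => rw [p.as_sum, map_sum, Polynomial.finsetSum_coeff]
    simp_rw [scaleHom_monomial, Polynomial.coeff_monomial]
    rw [← Finset.sum_filter, map_sum]
  rw [h, Ne, map_eq_zero_iff _ (IsFractionRing.injective (Poly N) (RatFn N))]
  intro h0
  have := congrArg (coeff d) h0
  rw [coeff_sum, coeff_zero] at this
  simp_rw [coeff_monomial] at this
  rw [Finset.sum_ite_eq' , if_pos (by simp [mem_support_iff.1 hd])] at this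
  exact mem_support_iff.1 hd this

/-- This turns the degree conditions on `R` into bounds on every exponent of its numerator. -/
theorem le_intDegree_scale (I : Finset (Fin N)) {R : RatFn N} {p b : Poly N}
    (hb : b ≠ 0) (h : R * algebraMap (Poly N) (RatFn N) b = algebraMap (Poly N) (RatFn N) p)
    {d : Fin N →₀ ℕ} (hd : d ∈ p.support) :
    ∑ v ∈ I, (d v : ℤ) ≤ (scale I R).intDegree + (scaleHom I b).natDegree := by
  have hp : p ≠ 0 := by
    rintro rfl
    simp at hd
  have hR : R ≠ 0 := by
    rintro rfl
    rw [zero_mul, eq_comm, map_eq_zero_iff _ (IsFractionRing.injective (Poly N) (RatFn N))] at h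
    exact hp h
  have hR' : scale I R ≠ 0 := by
    rwa [Ne, map_eq_zero_iff _ (scale_injective I)]
  have hb' : algebraMap (Polynomial (RatFn N)) (RatFunc (RatFn N)) (scaleHom I b) ≠ 0 := by
    rw [Ne, map_eq_zero_iff _ (RatFunc.algebraMap_injective (RatFn N)),
      map_eq_zero_iff _ (scaleHom_injective I)]
    exact hb
  have h1 := congrArg (fun f => (scale I f).intDegree) h
  simp only [map_mul, scale_algebraMap] at h1
  rw [RatFunc.intDegree_mul hR' hb', RatFunc.intDegree_polynomial,
    RatFunc.intDegree_polynomial] at h1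
  rw [h1, ← Nat.cast_sum, Nat.cast_le]
  exact Polynomial.le_natDegree_of_ne_zero (coeff_scaleHom_ne_zero I hd)

theorem eq_of_algebraMap_eq_zpow_mul {F : Type*} [Field F] {f : Polynomial F} {a : ℤ} {c : F}
    (h : algebraMap (Polynomial F) (RatFunc F) f = RatFunc.X ^ a * RatFunc.C c) {k : ℕ}
    (hk : f.coeff k ≠ 0) : (k : ℤ) = a := by
  obtain ⟨u, w, rfl⟩ : ∃ u w : ℕ, a = u - w := ⟨a.toNat, (-a).toNat, by omega⟩
  have h1 : f * Polynomial.X ^ w = Polynomial.X ^ u * Polynomial.C c := by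
    apply RatFunc.algebraMap_injective F
    rw [map_mul, map_mul, map_pow, map_pow, h, RatFunc.algebraMap_X, RatFunc.algebraMap_C,
      zpow_sub₀ RatFunc.X_ne_zero, zpow_natCast, zpow_natCast]
    have := pow_ne_zero w (RatFunc.X_ne_zero (K := F))
    field_simp
  have h2 := congrArg (fun g => Polynomial.coeff g (k + w)) h1
  simp only [Polynomial.coeff_mul_X_pow, Polynomial.coeff_X_pow_mul', Polynomial.coeff_C] at h2
  rw [h2] at hk
  split_ifs at hk <;> first | omega | simp at hk

end Scale

/-! ### Degrees of the shuffle denominator. -/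

section Denominator

variable {N : ℕ}

/-- The factor `t z_i - q z_j` of the denominator of a shuffle element (`1` for `i = j`). -/
def denFactor (i j : Fin N) : Poly N := if i = j then 1 else C t * X i - C q * X j

/-- The denominator of a shuffle element, multiplied by a power of the product of the variables. -/
def denPoly (N e : ℕ) : Poly N := (∏ i, ∏ j, denFactor i j) * (∏ i, X i) ^ e

theorem algebraMap_denPoly (e : ℕ) : algebraMap (Poly N) (RatFn N) (denPoly N e) =
    shuffleDen N * (∏ i, z i) ^ e := by
  have h : ∀ (c : 𝕂) (i : Fin N), algebraMap (Poly N) (RatFn N) (C c * X i) = c • z i := by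
    intro c i
    rw [z, map_mul, ← MvPolynomial.algebraMap_eq, ← IsScalarTower.algebraMap_apply,
      Algebra.smul_def]
  simp only [denPoly, denFactor, shuffleDen, map_mul, map_prod, map_pow]
  congr 1
  refine Finset.prod_congr rfl fun i _ => Finset.prod_congr rfl fun j _ => ?_
  split_ifs
  · rw [map_one]
  · rw [map_sub, h, h]

theorem eval_denPoly_ne_zero (e : ℕ) {x : Fin N → 𝕂} (hx : ∀ i, x i ≠ 0)
    (h : ∀ i j, i ≠ j → t * x i ≠ q * x j) : eval x (denPoly N e) ≠ 0 := by
  simp only [denPoly, denFactor, map_mul, map_prod, map_pow, eval_X]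
  refine mul_ne_zero (Finset.prod_ne_zero_iff.2 fun i _ => Finset.prod_ne_zero_iff.2 fun j _ => ?_)
    (pow_ne_zero _ (Finset.prod_ne_zero_iff.2 fun i _ => hx i))
  split_ifs with hij
  · simp
  · simpa [sub_eq_zero] using h i j hij

theorem t_mul_pow_ne (i j : ℕ) : t * q ^ i ≠ q * q ^ j := by
  intro h
  have := generic_q_t.eq_of_mul_eq i 1 (j + 1) 0 (by
    rw [zpow_add_one₀ generic_q_t.q_ne_zero]
    simp only [zpow_natCast, zpow_one, zpow_zero, mul_one]
    rw [mul_comm, h, mul_comm])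
  omega

theorem eval_denPoly_pow_ne_zero (e : ℕ) :
    eval (fun i : Fin N => q ^ (i : ℕ)) (denPoly N e) ≠ 0 :=
  eval_denPoly_ne_zero e (fun _ => pow_ne_zero _ generic_q_t.q_ne_zero)
    fun i j _ => t_mul_pow_ne i j

theorem denPoly_ne_zero (N e : ℕ) : denPoly N e ≠ 0 := by
  intro h
  have := eval_denPoly_pow_ne_zero (N := N) e
  rw [h, map_zero] at this
  exact this rfl

theorem shuffleDen_ne_zero (N : ℕ) : shuffleDen N ≠ 0 := by
  have := algebraMap_denPoly (N := N) 0
  rw [pow_zero, mul_one] at this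
  rw [← this, Ne, map_eq_zero_iff _ (IsFractionRing.injective (Poly N) (RatFn N))]
  exact denPoly_ne_zero N 0

/-- Of the `N²` ordered pairs, discard the `(N - i)²` that avoid `I` and the `i` diagonal ones
inside `I`, where `i` is the size of `I`. -/
theorem sum_sum_ite_mem (I : Finset (Fin N)) :
    ∑ i : Fin N, ∑ j : Fin N, (if i ≠ j ∧ (i ∈ I ∨ j ∈ I) then 1 else 0 : ℤ) =
      I.card * (2 * N - I.card - 1) := by
  have h : ∀ i j : Fin N, (if i ≠ j ∧ (i ∈ I ∨ j ∈ I) then 1 else 0 : ℤ) =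
      1 - (if i ∈ Iᶜ then 1 else 0) * (if j ∈ Iᶜ then 1 else 0) -
        (if i = j then (if i ∈ I then 1 else 0) else 0) := by
    intro i j
    simp only [Finset.mem_compl]
    by_cases hij : i = j
    · subst hij; by_cases hi : i ∈ I <;> simp [hi]
    · by_cases hi : i ∈ I <;> by_cases hj : j ∈ I <;> simp [hi, hj, hij]
  simp_rw [h, Finset.sum_sub_distrib, ← Finset.mul_sum, ← Finset.sum_mul, Finset.sum_ite_eq]
  simp only [Finset.sum_const, Finset.card_univ, Fintype.card_fin, Finset.sum_ite_mem,
    Finset.univ_inter, Finset.card_compl, nsmul_eq_mul, mul_one, Finset.mem_univ, if_true]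
  have hI : I.card ≤ N := by simpa using Finset.card_le_univ I
  push_cast [hI]
  ring

theorem scaleHom_X (I : Finset (Fin N)) (i : Fin N) : scaleHom I (X i) =
    if i ∈ I then Polynomial.X * Polynomial.C (z i) else Polynomial.C (z i) := by
  simp [scaleHom]

theorem scaleHom_C (I : Finset (Fin N)) (c : 𝕂) :
    scaleHom I (C c) = Polynomial.C (algebraMap 𝕂 (RatFn N) c) := by
  rw [← MvPolynomial.algebraMap_eq, AlgHom.commutes, ← Polynomial.algebraMap_eq,
    ← IsScalarTower.algebraMap_apply]

theorem natDegree_scaleHom_X_le (I : Finset (Fin N)) (i : Fin N) :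
    (scaleHom I (X i)).natDegree ≤ if i ∈ I then 1 else 0 := by
  rw [scaleHom_X]
  split_ifs
  · exact (Polynomial.natDegree_mul_C_le _ _).trans Polynomial.natDegree_X_le
  · rw [Polynomial.natDegree_C]

theorem natDegree_scaleHom_denFactor_le (I : Finset (Fin N)) (i j : Fin N) :
    (scaleHom I (denFactor i j)).natDegree ≤ if i ≠ j ∧ (i ∈ I ∨ j ∈ I) then 1 else 0 := by
  by_cases hij : i = j
  · simp [denFactor, hij]
  · rw [denFactor, if_neg hij, map_sub, map_mul, map_mul, scaleHom_C, scaleHom_C]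
    refine (Polynomial.natDegree_sub_le _ _).trans (max_le ?_ ?_)
    · refine (Polynomial.natDegree_C_mul_le _ _).trans ((natDegree_scaleHom_X_le I i).trans ?_)
      by_cases hi : i ∈ I <;> simp [hi, hij]
    · refine (Polynomial.natDegree_C_mul_le _ _).trans ((natDegree_scaleHom_X_le I j).trans ?_)
      by_cases hj : j ∈ I <;> simp [hj, hij]

theorem natDegree_scaleHom_denPoly_le (I : Finset (Fin N)) (e : ℕ) :
    ((scaleHom I (denPoly N e)).natDegree : ℤ) ≤
      I.card * (2 * N - I.card - 1) + e * I.card := by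
  have h1 : (scaleHom I (∏ i, ∏ j, denFactor i j)).natDegree ≤
      ∑ i : Fin N, ∑ j : Fin N, if i ≠ j ∧ (i ∈ I ∨ j ∈ I) then 1 else 0 := by
    rw [map_prod]
    refine (Polynomial.natDegree_prod_le _ _).trans (Finset.sum_le_sum fun i _ => ?_)
    rw [map_prod]
    exact (Polynomial.natDegree_prod_le _ _).trans
      (Finset.sum_le_sum fun j _ => natDegree_scaleHom_denFactor_le I i j)
  have h2 : (scaleHom I (∏ i, X i)).natDegree ≤ I.card := by
    rw [map_prod]
    refine (Polynomial.natDegree_prod_le _ _).trans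
      ((Finset.sum_le_sum fun i _ => natDegree_scaleHom_X_le I i).trans ?_)
    simp
  have h3 : (scaleHom I (denPoly N e)).natDegree ≤
      (∑ i : Fin N, ∑ j : Fin N, if i ≠ j ∧ (i ∈ I ∨ j ∈ I) then 1 else 0) + e * I.card := by
    rw [denPoly, map_mul, map_pow]
    exact Polynomial.natDegree_mul_le.trans (add_le_add h1
      (Polynomial.natDegree_pow_le.trans (Nat.mul_le_mul_left e h2)))
  have h4 := sum_sum_ite_mem I
  zify at h3
  rwa [h4] at h3

theorem scaleHom_univ_X (i : Fin N) : scaleHom Finset.univ (X i) =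
    Polynomial.X * Polynomial.C (algebraMap (Poly N) (RatFn N) (X i)) := by
  rw [scaleHom_X, if_pos (Finset.mem_univ i), z]

theorem scaleHom_univ_denPoly (e : ℕ) : scaleHom Finset.univ (denPoly N e) =
    Polynomial.X ^ (N * (N - 1) + N * e) *
      Polynomial.C (algebraMap (Poly N) (RatFn N) (denPoly N e)) := by
  have h1 : ∀ i j : Fin N, scaleHom Finset.univ (denFactor i j) =
      Polynomial.X ^ (if i = j then 0 else 1) *
        Polynomial.C (algebraMap (Poly N) (RatFn N) (denFactor i j)) := by
    intro i j
    by_cases hij : i = j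
    · simp [denFactor, hij]
    · simp only [denFactor, if_neg hij, map_sub, map_mul, scaleHom_univ_X, scaleHom_C]
      have : ∀ c : 𝕂, algebraMap (Poly N) (RatFn N) (C c) = algebraMap 𝕂 (RatFn N) c := by
        intro c
        rw [← MvPolynomial.algebraMap_eq, ← IsScalarTower.algebraMap_apply]
      simp only [this]
      ring
  have h2 : ∀ i : Fin N, ∑ j : Fin N, (if i = j then 0 else 1) = N - 1 := by
    intro i
    have : ∀ j : Fin N, (if i = j then 0 else 1) = if j ∈ Finset.univ.erase i then 1 else 0 := by
      intro j
      by_cases hij : i = j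
      · simp [hij]
      · simp [hij, Ne.symm hij]
    simp_rw [this, Finset.sum_ite_mem]
    simp
  simp only [denPoly, map_mul, map_prod, map_pow, h1, scaleHom_univ_X, Finset.prod_mul_distrib,
    Finset.prod_pow_eq_pow_sum, h2, Finset.prod_const, Finset.sum_const, Finset.card_univ,
    Fintype.card_fin, smul_eq_mul]
  ring

theorem sum_eq_of_isHomog {M : ℤ} {R : RatFn N} (hR : IsHomog M R) {p : Poly N} {e : ℕ}
    (h : R * algebraMap (Poly N) (RatFn N) (denPoly N e) = algebraMap (Poly N) (RatFn N) p)
    {d : Fin N →₀ ℕ} (hd : d ∈ p.support) :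
    ∑ v, (d v : ℤ) = M + N * (N - 1) + N * e := by
  have h1 := congrArg (scale Finset.univ) h
  rw [map_mul, hR, scale_algebraMap, scale_algebraMap, scaleHom_univ_denPoly, map_mul, map_pow,
    RatFunc.algebraMap_X, RatFunc.algebraMap_C] at h1
  have h2 : algebraMap (Polynomial (RatFn N)) (RatFunc (RatFn N)) (scaleHom Finset.univ p) =
      RatFunc.X ^ (M + (N * (N - 1) + N * e : ℕ)) *
        RatFunc.C (algebraMap (Poly N) (RatFn N) p) := by
    rw [← h1, ← h, map_mul, zpow_add₀ RatFunc.X_ne_zero, zpow_natCast]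
    ring
  have h3 := eq_of_algebraMap_eq_zpow_mul h2 (coeff_scaleHom_ne_zero Finset.univ hd)
  push_cast at h3
  rw [h3]
  rcases Nat.eq_zero_or_pos N with rfl | hN
  · simp
  · push_cast [Nat.one_le_iff_ne_zero.2 hN.ne']
    ring

end Denominator

/-! ### From solutions to polynomials, and the conclusion. -/

section Uniqueness

variable {N : ℕ}

theorem renameRat_algebraMap {a : ℕ} (e : Fin a ↪ Fin N) (p : Poly a) :
    renameRat e (algebraMap (Poly a) (RatFn a) p) =
      algebraMap (Poly N) (RatFn N) (rename e p) :=
  IsFractionRing.lift_algebraMap (renamePoly_injective e) p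

theorem IsShuffle.exists_poly {R : RatFn N} (hR : IsShuffle R) :
    ∃ (p : Poly N) (e : ℕ),
      R * algebraMap (Poly N) (RatFn N) (denPoly N e) = algebraMap (Poly N) (RatFn N) p ∧
      (∀ σ : Equiv.Perm (Fin N), rename σ p = p) ∧ PolyWheel q t p := by
  obtain ⟨r, ⟨p, e, hp⟩, hs, hw, rfl⟩ := hR
  refine ⟨p, e, ?_, ?_, ?_⟩
  · rw [algebraMap_denPoly, ← mul_assoc, div_mul_cancel₀ _ (shuffleDen_ne_zero N), hp]
  · intro σ
    apply IsFractionRing.injective (Poly N) (RatFn N)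
    have h1 := renameRat_algebraMap σ.toEmbedding p
    have h2 : ∀ i, renameRat σ.toEmbedding (z i) = z (σ i) := by
      intro i
      rw [z, renameRat_algebraMap, rename_X]
      rfl
    rw [← hp, map_mul, hs, map_pow, map_prod] at h1
    simp_rw [h2] at h1
    rw [Equiv.prod_comp σ z, hp] at h1
    exact h1.symm
  · intro x hx u v w huv huw
    have hq := generic_q_t.q_ne_zero
    have ht := generic_q_t.t_ne_zero
    -- Both positions of `w` give the ratios `q, 1/t, t/q`, in different orders; the set forgets the
    -- order.
    have h0 := hw x hx v u w (Or.inl (by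
      have hu := hx u
      rcases huw with huw | huw
      · have e1 : x v / x u = q := by rw [huv]; field_simp
        have e2 : x u / x w = 1 / t := by rw [huw]; field_simp
        have e3 : x w / x v = t / q := by rw [huv, huw]; field_simp
        rw [e1, e2, e3]
      · have huw' : x w = q * x u / t := by rw [← huw]; field_simp
        have e1 : x v / x u = q := by rw [huv]; field_simp
        have e2 : x u / x w = t / q := by rw [huw']; field_simp
        have e3 : x w / x v = 1 / t := by rw [huv, huw']; field_simp
        rw [e1, e2, e3, Set.pair_comm (t / q)]))
    rw [evalAt_laurent hx hp, div_eq_zero_iff] at h0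
    exact h0.resolve_right (pow_ne_zero _ (Finset.prod_ne_zero_iff.2 fun i _ => hx i))

/-- The geometric progression `(1, q, …, q^{N-1})`. -/
abbrev qPoint (N : ℕ) : Fin N → 𝕂 := fun i => q ^ (i : ℕ)

/-- `evalAt` uses the reduced fraction and need not be additive at poles; shuffle denominators do
not vanish at the geometric progression. -/
theorem IsShuffle.evalAt_sub {R S : RatFn N} (hR : IsShuffle R) (hS : IsShuffle S) :
    evalAt (qPoint N) (R - S) = evalAt (qPoint N) R - evalAt (qPoint N) S := by
  obtain ⟨p, e, hp, -⟩ := hR.exists_poly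
  obtain ⟨p', e', hp', -⟩ := hS.exists_poly
  have h1 := eval_denPoly_pow_ne_zero (N := N) e
  have h2 := eval_denPoly_pow_ne_zero (N := N) e'
  rw [evalAt_eq _ R p _ h1 hp, evalAt_eq _ S p' _ h2 hp',
    evalAt_eq _ (R - S) (p * denPoly N e' - p' * denPoly N e) (denPoly N e * denPoly N e')
      (by rw [map_mul]; exact mul_ne_zero h1 h2) (by
        simp only [map_mul, map_sub, ← hp, ← hp']
        ring), map_sub, map_mul, map_mul, map_mul, div_sub_div _ _ h1 h2]
  ring

theorem evalAt_eq_of_phi_eq {m : ℤ} {n k : ℕ} {R S : RatFn (k * n)}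
    (h : phi m n k R = phi m n k S) :
    evalAt (qPoint (k * n)) R = evalAt (qPoint (k * n)) S := by
  have hg := generic_q_t
  have h1 : ∏ i ∈ Finset.Icc 1 (k * n), (t - q ^ i) / (1 - q ^ i) ≠ 0 := by
    refine Finset.prod_ne_zero_iff.2 fun i hi => div_ne_zero ?_ ?_
    · rw [sub_ne_zero]
      intro h
      have := hg.eq_of_mul_eq 0 1 i 0 (by simpa using h)
      omega
    · rw [sub_ne_zero]
      intro h
      have := hg.eq_of_mul_eq 0 0 i 0 (by simpa using h)
      rw [Finset.mem_Icc] at hi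
      omega
  rw [phi, phi] at h
  exact mul_right_cancel₀ (hg.zpow_ne _) (mul_right_cancel₀ h1 h)

theorem intDegree_X_zpow {F : Type*} [Field F] (a : ℤ) :
    ((RatFunc.X : RatFunc F) ^ a).intDegree = a := by
  have h : ∀ u : ℕ, ((RatFunc.X : RatFunc F) ^ u).intDegree = u := by
    intro u
    rw [← RatFunc.algebraMap_X, ← map_pow, RatFunc.intDegree_polynomial, Polynomial.natDegree_X_pow]
  obtain ⟨u, rfl | rfl⟩ := a.eq_nat_or_neg
  · rw [zpow_natCast, h]
  · rw [zpow_neg, RatFunc.intDegree_inv, zpow_natCast, h]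

/-- The hypotheses exclude zero because `intDegree 0 = 0` stands in for `-∞`. -/
theorem intDegree_sub_lt {F : Type*} [Field F] {f g : RatFunc F} {d : ℚ}
    (hf : f ≠ 0 → (f.intDegree : ℚ) < d) (hg : g ≠ 0 → (g.intDegree : ℚ) < d)
    (hfg : f - g ≠ 0) : ((f - g).intDegree : ℚ) < d := by
  by_cases h1 : g = 0
  · subst h1
    rw [sub_zero] at hfg ⊢
    exact hf hfg
  by_cases h2 : f = 0
  · subst h2
    rw [zero_sub, RatFunc.intDegree_neg]
    exact hg h1
  rw [sub_eq_add_neg] at hfg ⊢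
  have := RatFunc.intDegree_add_le (neg_ne_zero.2 h1) hfg
  rw [RatFunc.intDegree_neg] at this
  calc ((f + -g).intDegree : ℚ) ≤ ((max f.intDegree g.intDegree : ℤ) : ℚ) := by
        exact_mod_cast this
    _ < d := by rw [Int.cast_max]; exact max_lt (hf h2) (hg h1)

theorem HasLimit.intDegree_sub_lt {F : Type*} [Field F] {f g : RatFunc F} {a : F}
    (hf : HasLimit f a) (hg : HasLimit g a) (hfg : f - g ≠ 0) : (f - g).intDegree < 0 := by
  have key : ∀ f : RatFunc F, HasLimit f a → f - RatFunc.C a ≠ 0 →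
      ((f - RatFunc.C a).intDegree : ℚ) < 0 := by
    intro f hf h
    exact_mod_cast hf.resolve_left (sub_ne_zero.1 h)
  have := Shuffle.intDegree_sub_lt (key f hf) (key g hg) (by simpa using hfg)
  simpa using this

/-- The set of the first `i` variables. -/
abbrev initialVars (N i : ℕ) : Finset (Fin N) := Finset.univ.filter fun j : Fin N => (j : ℕ) < i

theorem card_initialVars {i : ℕ} (hi : i ≤ N) : (initialVars N i).card = i := by
  rw [initialVars, Fin.card_filter_val_lt, min_eq_right hi]

namespace IsSolution

variable {m : ℤ} {n k : ℕ} {c : 𝕂}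
  {T : ∀ l : ℕ, slopePiece m n l ⊗[𝕂] slopePiece m n (k - l)} {R R' : RatFn (k * n)}

theorem intDegree_lt (hR : IsSolution m n k c T R) {I : Finset (Fin (k * n))} (h0 : 0 < I.card)
    (h1 : I.card < k * n) (hI : ¬∃ l : ℕ, 0 < l ∧ l < k ∧ I.card = l * n)
    (hne : scale I R ≠ 0) : ((scale I R).intDegree : ℚ) < m * I.card / n := by
  have hR0 : R ≠ 0 := by
    rintro rfl
    simp at hne
  exact lt_of_le_of_ne (hR.deg_le I h0 h1 hR0) fun h => hI (hR.deg_eq I h0 h1 ⟨hR0, h⟩)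

/-- The degree of the difference of two solutions in the first `i` variables is less than
`m i / n`. -/
theorem intDegree_scale_sub_lt (hn : 0 < n) (hR : IsSolution m n k c T R)
    (hR' : IsSolution m n k c T R') (hne : R - R' ≠ 0) {i : ℕ} (h0 : 0 < i) (h1 : i < k * n) :
    n * (scale (initialVars (k * n) i) (R - R')).intDegree < m * i := by
  have hcard := card_initialVars h1.le
  have hne' : scale (initialVars (k * n) i) (R - R') ≠ 0 := by
    rwa [Ne, map_eq_zero_iff _ (scale_injective _)]
  by_cases hI : ∃ l : ℕ, 0 < l ∧ l < k ∧ i = l * n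
  · obtain ⟨l, hl0, hlk, rfl⟩ := hI
    have hX : (RatFunc.X : RatFunc (RatFn (k * n))) ^ (m * l) ≠ 0 :=
      zpow_ne_zero _ RatFunc.X_ne_zero
    -- Equal limits cancel, so the quotient by `ξ^{ml}` has negative degree.
    have := (hR.limit l hl0 hlk).intDegree_sub_lt (hR'.limit l hl0 hlk) (by
      rw [← sub_div, ← map_sub]
      exact div_ne_zero hne' hX)
    rw [← sub_div, ← map_sub, div_eq_mul_inv, RatFunc.intDegree_mul hne' (inv_ne_zero hX),
      RatFunc.intDegree_inv, intDegree_X_zpow, ← sub_eq_add_neg, sub_neg] at this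
    have h2 := mul_lt_mul_of_pos_left this (Int.natCast_pos.2 hn)
    push_cast
    linarith
  · rw [map_sub] at hne' ⊢
    have := Shuffle.intDegree_sub_lt (d := m * i / n)
      (fun h => by simpa only [hcard] using
        hR.intDegree_lt (by rwa [hcard]) (by rwa [hcard]) (by rwa [hcard]) h)
      (fun h => by simpa only [hcard] using
        hR'.intDegree_lt (by rwa [hcard]) (by rwa [hcard]) (by rwa [hcard]) h) hne'
    rw [lt_div_iff₀ (by exact_mod_cast hn)] at this
    rw [mul_comm]
    exact_mod_cast this

end IsSolution

theorem exists_perm_map_eq {I J : Finset (Fin N)} (h : I.card = J.card) :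
    ∃ σ : Equiv.Perm (Fin N), I.map σ.toEmbedding = J := by
  classical
  let e : {x // x ∈ I} ≃ {x // x ∈ J} := Finset.equivOfCardEq h
  refine ⟨e.extendSubtype, Finset.eq_of_subset_of_card_le ?_ (by rw [Finset.card_map, h])⟩
  intro y hy
  obtain ⟨x, hx, rfl⟩ := Finset.mem_map.1 hy
  exact e.extendSubtype_mem x hx

/-- For symmetric polynomials the strict slope conditions need to be checked only for initial
segments of the variables. -/
theorem strictSlope_of_initialVars {n : ℕ} {M : ℤ} {p : Poly N}
    (hs : ∀ σ : Equiv.Perm (Fin N), rename σ p = p)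
    (hlt : ∀ d ∈ p.support, ∀ i : ℕ, 0 < i → i < N →
      n * ∑ v ∈ initialVars N i, (d v : ℤ) < M * i + n * (i * (2 * N - i - 1)))
    (heq : ∀ d ∈ p.support, n * ∑ v, (d v : ℤ) = M * N + n * (N * (N - 1))) :
    StrictSlope n M p := by
  refine ⟨fun d hd I h0 h1 => ?_, by simpa using heq⟩
  rw [Fintype.card_fin] at h1 ⊢
  obtain ⟨σ, hσ⟩ := exists_perm_map_eq (card_initialVars h1.le)
  have hd' : d.mapDomain σ.symm ∈ p.support := by
    rw [mem_support_iff, ← hs σ.symm, coeff_rename_mapDomain _ σ.symm.injective]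
    exact mem_support_iff.1 hd
  have := hlt _ hd' I.card h0 h1
  rw [← hσ, Finset.sum_map, Finset.card_map, card_initialVars h1.le]
  convert this using 4 with v _
  rw [← Finsupp.equivMapDomain_eq_mapDomain, Finsupp.equivMapDomain_apply]
  simp

/-- The equality in `StrictSlope` makes `p` homogeneous, as `n` is nonzero. -/
theorem eval_mul_eq_zero {p : Poly N} {n : ℕ} (hn : 0 < n) {M : ℤ} (hp : StrictSlope n M p)
    {x : Fin N → 𝕂} (hx : eval x p = 0) (y : 𝕂) : eval (fun v => y * x v) p = 0 := by
  by_cases h0 : p = 0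
  · simp [h0]
  obtain ⟨d₀, hd₀⟩ := support_nonempty.2 h0
  have hdeg : ∀ d ∈ p.support, ∑ v, d v = ∑ v, d₀ v := by
    intro d hd
    have h1 := (hp.eq d hd).trans (hp.eq d₀ hd₀).symm
    have h2 := mul_left_cancel₀ (by exact_mod_cast hn.ne') h1
    exact_mod_cast h2
  rw [eval_eq'] at hx ⊢
  calc _ = ∑ d ∈ p.support, y ^ (∑ v, d₀ v) * (coeff d p * ∏ v, x v ^ d v) := by
        refine Finset.sum_congr rfl fun d hd => ?_
        rw [← hdeg d hd]
        simp_rw [mul_pow, Finset.prod_mul_distrib, Finset.prod_pow_eq_pow_sum]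
        ring
    _ = 0 := by rw [← Finset.mul_sum, hx, mul_zero]

/-- `N` distinct positions in an interval of length `N` fill it, so the point is a permutation of
`(1, q, …, q^{N-1})` scaled by `q ^ lo * y`. -/
theorem eval_string_eq_zero {p : Poly N} {n : ℕ} (hn : 0 < n) {M : ℤ} (hp : StrictSlope n M p)
    (hs : ∀ σ : Equiv.Perm (Fin N), rename σ p = p) (h0 : eval (qPoint N) p = 0)
    {e : Fin N → ℤ} {lo : ℤ} (he : Function.Injective e)
    (hlo : ∀ v, lo ≤ e v ∧ e v < lo + N) (y : 𝕂) : eval (fun v => q ^ e v * y) p = 0 := by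
  let f : Fin N → Fin N := fun v => ⟨(e v - lo).toNat, by have := hlo v; omega⟩
  have hf : Function.Injective f := by
    intro u v huv
    have h1 := congrArg Fin.val huv
    have hu := hlo u
    have hv := hlo v
    simp only [f] at h1
    exact he (by omega)
  let σ : Equiv.Perm (Fin N) := Equiv.ofBijective f (Finite.injective_iff_bijective.1 hf)
  have h1 : eval (fun v => qPoint N (σ v)) p = 0 := by
    have := eval_rename σ (qPoint N) p
    rw [hs σ, h0] at this
    exact this.symm
  rw [← eval_mul_eq_zero hn hp h1 (q ^ lo * y)]
  congr 2
  funext v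
  have : e v = lo + (f v : ℕ) := by
    have := hlo v
    simp only [f]
    omega
  rw [this, zpow_add₀ generic_q_t.q_ne_zero, zpow_natCast]
  simp only [σ, Equiv.ofBijective_apply]
  ring

theorem IsSolution.eq {m : ℤ} {n k : ℕ} (hn : 0 < n) (hk : 0 < k) {c : 𝕂}
    {T : ∀ l : ℕ, slopePiece m n l ⊗[𝕂] slopePiece m n (k - l)} {R R' : RatFn (k * n)}
    (hR : IsSolution m n k c T R) (hR' : IsSolution m n k c T R') : R = R' := by
  by_contra hne
  rw [← sub_eq_zero] at hne
  have hsh : IsShuffle (R - R') := by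
    have := hR.shuffle.add (hR'.shuffle.smul (-1))
    rwa [neg_one_smul, ← sub_eq_add_neg] at this
  have hhom : IsHomog (k * m) (R - R') := by
    rw [IsHomog, map_sub, hR.homog, hR'.homog, map_sub, mul_sub]
  obtain ⟨p, e, hp, hs, hw⟩ := hsh.exists_poly
  have hnk : ((k * n : ℕ) : ℤ) = k * n := by push_cast; rfl
  -- Clearing the monomial `(∏ z_i)^e` raises the degree in `i` variables by `e i`, so the slope
  -- `m/n` becomes `m/n + e`.
  have hslope : StrictSlope n (m + e * n) p := by
    refine strictSlope_of_initialVars hs ?_ ?_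
    · intro d hd i h0 h1
      have h2 := le_intDegree_scale (initialVars (k * n) i) (denPoly_ne_zero _ e) hp hd
      have h3 := natDegree_scaleHom_denPoly_le (initialVars (k * n) i) e
      have h4 := hR.intDegree_scale_sub_lt hn hR' hne h0 h1
      rw [card_initialVars h1.le] at h3
      have h5 := mul_le_mul_of_nonneg_left (h2.trans (add_le_add_right h3 _))
        (Int.natCast_nonneg n)
      linarith
    · intro d hd
      rw [sum_eq_of_isHomog hhom hp hd, hnk]
      ring
  have heval : eval (qPoint (k * n)) p = 0 := by
    have h1 := hR.shuffle.evalAt_sub hR'.shuffle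
    rw [evalAt_eq_of_phi_eq (hR.norm.trans hR'.norm.symm), sub_self,
      evalAt_eq _ _ p _ (eval_denPoly_pow_ne_zero e) hp, div_eq_zero_iff] at h1
    exact h1.resolve_right (eval_denPoly_pow_ne_zero e)
  have hp0 := eq_zero_of_strictSlope (Nat.mul_pos hk hn) generic_q_t hslope hw
    fun e' lo he hlo y _ => eval_string_eq_zero hn hslope hs heval he hlo y
  rw [hp0, map_zero, mul_eq_zero] at hp
  refine hp.elim hne fun h => denPoly_ne_zero (k * n) e ?_
  rwa [map_eq_zero_iff _ (IsFractionRing.injective (Poly (k * n)) (RatFn (k * n)))] at h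

end Uniqueness

end Shuffle

end

theorem mainTheorem7 (m : ℤ) (n k : ℕ) (hn : 0 < n) (hk : 0 < k) (hmn : IsCoprime m (n : ℤ))
    (c : Shuffle.𝕂)
    (T : ∀ l : ℕ, TensorProduct Shuffle.𝕂 (Shuffle.slopePiece m n l)
      (Shuffle.slopePiece m n (k - l)))
    (R R' : Shuffle.RatFn (k * n))
    (hR : Shuffle.IsSolution m n k c T R) (hR' : Shuffle.IsSolution m n k c T R') :
    R = R' :=
  hR.eq hn hk hR'
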